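/- **Theorem.** Let $A$ be a finite alphabet. A class of languages over $A$ is a quotient-closed Boolean algebra if it contains $A^*$, is closed under union, intersection and complement, and contains $w^{-1}L=\{u\mid wu\in L\}$ and $Lw^{-1}=\{u\mid uw\in L\}$ for every $L$ in the class and every $w\in A^*$. Let $\mathcal C$ be a finite quotient-closed Boolean algebra. Write $w\sim_{\mathcal C}w'$ when $w$ and $w'$ belong to the same languages of $\mathcal C$; this is a congruence on $A^*$. Write $[w]_{\mathcal C}$ for the class of $w$ and $\bullet$ for the multiplication of the monoid $A^*/{\sim_{\mathcal C}}$. Let $SF(\mathcal C)$ be the star-free closure of $\mathcal C$, that is, the least class of languages containing $\mathcal C$ and $\{a\}$ for every $a\in A$ and closed under union, intersection, complement and concatenation. Let $(R,+,\cdot)$ be a finite idempotent semiring (a semiring with $r+r=r$ for all $r$), ordered by $r\le s\iff r+s=s$. Let $\rho:2^{A^*}\to R$ be a nice multiplicative rating map. Multiplicative rating map means that $\rho(\emptyset)=0_R$, $\rho(\{\varepsilon\})=1_R$, $\rho(K\cup L)=\rho(K)+\rho(L)$ and $\rho(KL)=\rho(K)\rho(L)$ for all $K,L\subseteq A^*$.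 Nice means that for every nonempty $K\subseteq A^*$ there are finitely many words $w_1,\dots,w_n\in K$ with $\rho(K)=\rho(\{w_1\})+\cdots+\rho(\{w_n\})$. An $SF(\mathcal C)$-cover of a language $L$ is a finite set $\mathbf K\subseteq SF(\mathcal C)$ with $L\subseteq\bigcup_{K\in\mathbf K}K$. Its $\rho$-imprint is $\{r\in R\mid r\le\rho(K)\text{ for some }K\in\mathbf K\}$. The cover is optimal if its $\rho$-imprint is included in that of every $SF(\mathcal C)$-cover of $L$. Optimal covers exist and all have the same $\rho$-imprint, denoted $\mathcal I_{SF(\mathcal C)}[L,\rho]$. Let $\omega$ be a positive integer such that $r^\omega\cdot r^\omega=r^\omega$ for all $r\in R$. A set $S\subseteq(A^*/{\sim_{\mathcal C}})\times R$ is called $SF(\mathcal C)$-saturated for $\rho$ if: 1. (trivial elements) $([w]_{\mathcal C},\rho(\{w\}))\in S$ for every $w\in A^*$; 2. (downset) if $(C,r)\in S$ and $q\le r$, then $(C,q)\in S$; 3. (multiplication) if $(C,q),(D,r)\in S$, then $(C\bullet D,qr)\in S$; 4. ($SF(\mathcal C)$-closure) if $(E,r)\in S$ and $E\bullet E=E$,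 then $(E,r^\omega+r^{\omega+1})\in S$. Then the set $$\{(C,r)\in(A^*/{\sim_{\mathcal C}})\times R\mid r\in\mathcal I_{SF(\mathcal C)}[C,\rho]\}$$ is the least (with respect to inclusion) $SF(\mathcal C)$-saturated subset of $(A^*/{\sim_{\mathcal C}})\times R$ for $\rho$. -/

import Mathlib

namespace StarFree

variable {A R : Type*}

/-! Classes of languages -/

/-- The right quotient `L w⁻¹ = {u | u w ∈ L}`. The left quotient `w⁻¹ L = {u | w u ∈ L}` is
`Language.leftQuotient`. -/
def rightQuotient (L : Language A) (w : List A) : Language A :=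
  {u : List A | u ++ w ∈ L}

/-- A class of languages is a Boolean algebra when it is closed under union, intersection and
complement. It contains `A*` (equivalently, it is nonempty). -/
structure IsBooleanAlgebra (C : Set (Language A)) : Prop where
  univ_mem : (⊤ : Language A) ∈ C
  union_mem : ∀ K ∈ C, ∀ L ∈ C, K ⊔ L ∈ C
  inter_mem : ∀ K ∈ C, ∀ L ∈ C, K ⊓ L ∈ C
  compl_mem : ∀ L ∈ C, Lᶜ ∈ C

/-- A quotient-closed Boolean algebra of languages. -/
structure IsQuotientClosedBooleanAlgebra (C : Set (Language A)) : Prop extends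
    IsBooleanAlgebra C where
  leftQuotient_mem : ∀ L ∈ C, ∀ w : List A, L.leftQuotient w ∈ C
  rightQuotient_mem : ∀ L ∈ C, ∀ w : List A, rightQuotient L w ∈ C

/-- The star-free closure of `C`: the least class containing `C` and the singletons `{a}` for
letters `a`, closed under the Boolean operations and concatenation. -/
inductive starFreeClosure (C : Set (Language A)) : Set (Language A)
  | base (L : Language A) (hL : L ∈ C) : starFreeClosure C L
  | letter (a : A) : starFreeClosure C ({[a]} : Language A)
  | union (K L : Language A) (hK : starFreeClosure C K) (hL : starFreeClosure C L) :
      starFreeClosure C (K ⊔ L)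
  | inter (K L : Language A) (hK : starFreeClosure C K) (hL : starFreeClosure C L) :
      starFreeClosure C (K ⊓ L)
  | compl (L : Language A) (hL : starFreeClosure C L) : starFreeClosure C Lᶜ
  | concat (K L : Language A) (hK : starFreeClosure C K) (hL : starFreeClosure C L) :
      starFreeClosure C (K * L)

/-- The star-free closure of a Boolean algebra is a Boolean algebra. -/
theorem isBooleanAlgebra_starFreeClosure {C : Set (Language A)} (hC : IsBooleanAlgebra C) :
    IsBooleanAlgebra (starFreeClosure C) where
  univ_mem := .base _ hC.univ_mem
  union_mem K hK L hL := .union K L hK hL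
  inter_mem K hK L hL := .inter K L hK hL
  compl_mem L hL := .compl L hL

/-- The canonical equivalence of `C`, `w ∼ w'` iff `w` and `w'` belong to the same languages of
`C`, as a congruence of the free monoid `A*`. -/
def canonicalCon (C : Set (Language A)) (hC : IsQuotientClosedBooleanAlgebra C) :
    Con (FreeMonoid A) where
  r w w' := ∀ L ∈ C, w.toList ∈ L ↔ w'.toList ∈ L
  iseqv :=
    ⟨fun _ _ _ => Iff.rfl, fun h L hL => (h L hL).symm,
      fun h h' L hL => (h L hL).trans (h' L hL)⟩
  mul' := by
    intro u u' v v' hu hv L hL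
    have h1 := hu _ (hC.rightQuotient_mem L hL v.toList)
    have h2 := hv _ (hC.leftQuotient_mem L hL u'.toList)
    exact h1.trans h2

/-- The set of `∼`-classes of `C`; it carries the quotient monoid structure. -/
abbrev Classes (C : Set (Language A)) (hC : IsQuotientClosedBooleanAlgebra C) : Type _ :=
  (canonicalCon C hC).Quotient

/-- The `∼`-class of a word. -/
def classOf (C : Set (Language A)) (hC : IsQuotientClosedBooleanAlgebra C) (w : List A) :
    Classes C hC :=
  ((FreeMonoid.ofList w : FreeMonoid A) : (canonicalCon C hC).Quotient)

/-- A `∼`-class, viewed as a language. -/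
def classLanguage {C : Set (Language A)} {hC : IsQuotientClosedBooleanAlgebra C}
    (c : Classes C hC) : Language A :=
  {w : List A | classOf C hC w = c}

/-! Covers -/

/-- `K` is a `D`-cover of `L`: a finite set of languages of `D` whose union contains `L`. -/
def IsCover (D : Set (Language A)) (L : Language A) (K : Set (Language A)) : Prop :=
  K.Finite ∧ K ⊆ D ∧ ∀ w ∈ L, ∃ H ∈ K, w ∈ H

/-! Rating maps -/

/-- A multiplicative rating map with rating set the idempotent semiring `R`: it sends `∅`, union,
`{ε}` and concatenation of languages (the `0`, `+`, `1` and `*` of `Language A`) to the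
`0`, `+`, `1` and `*` of `R`. (Rating sets are finite: this is the assumption `[Finite R]`.)
The order of `IdemSemiring R` is the canonical one: `r ≤ s ↔ r + s = s`. -/
abbrev MultiplicativeRatingMap (A R : Type*) [IdemSemiring R] := Language A →+* R

/-- A rating map is nice when the image of every nonempty language `K` is a finite sum
`ρ(w₁) + ⋯ + ρ(wₙ)` with `w₁, …, wₙ ∈ K`. -/
def IsNice [IdemSemiring R] (ρ : MultiplicativeRatingMap A R) : Prop :=
  ∀ K : Language A, (∃ w, w ∈ K) →
    ∃ F : Finset (List A), (∀ w ∈ F, w ∈ K) ∧ ρ K = ∑ w ∈ F, ρ ({w} : Language A)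

/-- The `ρ`-imprint of a set of languages. -/
def imprint [IdemSemiring R] (ρ : MultiplicativeRatingMap A R) (K : Set (Language A)) : Set R :=
  {r | ∃ H ∈ K, r ≤ ρ H}

/-- `K` is an optimal `D`-cover of `L` for `ρ`. -/
def IsOptimalCover [IdemSemiring R] (D : Set (Language A)) (L : Language A)
    (ρ : MultiplicativeRatingMap A R) (K : Set (Language A)) : Prop :=
  IsCover D L K ∧ ∀ K' : Set (Language A), IsCover D L K' → imprint ρ K ⊆ imprint ρ K'

/-- The `D`-optimal `ρ`-imprint on `L`: the imprint of any optimal `D`-cover of `L` for `ρ`. -/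
def optimalImprint [IdemSemiring R] (D : Set (Language A)) (L : Language A)
    (ρ : MultiplicativeRatingMap A R) : Set R :=
  {r | ∃ K, IsOptimalCover D L ρ K ∧ r ∈ imprint ρ K}

/-- All optimal covers have the same imprint. -/
theorem IsOptimalCover.imprint_eq [IdemSemiring R] {D : Set (Language A)} {L : Language A}
    {ρ : MultiplicativeRatingMap A R} {K : Set (Language A)} (hK : IsOptimalCover D L ρ K) :
    optimalImprint D L ρ = imprint ρ K :=
  Set.Subset.antisymm (fun _ ⟨_, hK', hr⟩ => hK'.2 K hK.1 hr) (fun _ hr => ⟨K, hK, hr⟩)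

/-- Optimal covers exist. -/
theorem exists_isOptimalCover [IdemSemiring R] [Finite R] {D : Set (Language A)}
    (hD : IsBooleanAlgebra D) (L : Language A) (ρ : MultiplicativeRatingMap A R) :
    ∃ K, IsOptimalCover D L ρ K := by
  have hmono : ∀ H H' : Language A, H ≤ H' → ρ H ≤ ρ H' := by
    intro H H' h
    rw [← add_eq_right_iff_le, ← map_add, add_eq_right_iff_le.2 h]
  have hne : {I : Set R | ∃ K, IsCover D L K ∧ imprint ρ K = I}.Nonempty :=
    ⟨_, {⊤}, ⟨Set.finite_singleton _, by simpa using hD.univ_mem,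
      fun w _ => ⟨⊤, rfl, Set.mem_univ w⟩⟩, rfl⟩
  obtain ⟨I, hI⟩ := (Set.toFinite {I : Set R | ∃ K, IsCover D L K ∧ imprint ρ K = I}).exists_minimal
    hne
  obtain ⟨K, hK, rfl⟩ := hI.1
  refine ⟨K, hK, fun K' hK' => ?_⟩
  have hcov : IsCover D L (Set.image2 (· ⊓ ·) K K') := by
    refine ⟨hK.1.image2 _ hK'.1, ?_, ?_⟩
    · rintro _ ⟨H, hH, H', hH', rfl⟩
      exact hD.inter_mem _ (hK.2.1 hH) _ (hK'.2.1 hH')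
    · intro w hw
      obtain ⟨H, hH, hwH⟩ := hK.2.2 w hw
      obtain ⟨H', hH', hwH'⟩ := hK'.2.2 w hw
      exact ⟨H ⊓ H', ⟨H, hH, H', hH', rfl⟩, hwH, hwH'⟩
  have h1 : imprint ρ (Set.image2 (· ⊓ ·) K K') ⊆ imprint ρ K := by
    rintro r ⟨_, ⟨H, hH, H', hH', rfl⟩, hr⟩
    exact ⟨H, hH, hr.trans (hmono _ _ inf_le_left)⟩
  have h2 : imprint ρ (Set.image2 (· ⊓ ·) K K') ⊆ imprint ρ K' := by
    rintro r ⟨_, ⟨H, hH, H', hH', rfl⟩, hr⟩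
    exact ⟨H', hH', hr.trans (hmono _ _ inf_le_right)⟩
  exact (hI.2 ⟨_, hcov, rfl⟩ h1).trans h2

/-- The pointed optimal imprint: the pairs `(c, r)` of a `∼`-class `c` of `C` and an element `r`
of the optimal `ρ`-imprint on `c` for the star-free closure of `C`. -/
def pointedOptimalImprint [IdemSemiring R] (C : Set (Language A))
    (hC : IsQuotientClosedBooleanAlgebra C) (ρ : MultiplicativeRatingMap A R) :
    Set (Classes C hC × R) :=
  {p | p.2 ∈ optimalImprint (starFreeClosure C) (classLanguage p.1) ρ}

/-! Saturated sets -/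

/-- The number `ω`: the least positive `n` such that `s ^ n` is idempotent for every `s`. -/
noncomputable def omegaExp (M : Type*) [Monoid M] : ℕ :=
  sInf {n | 0 < n ∧ ∀ s : M, IsIdempotentElem (s ^ n)}

/-- In a finite monoid, `ω` has the expected property. -/
theorem omegaExp_spec (M : Type*) [Monoid M] [Finite M] :
    0 < omegaExp M ∧ ∀ s : M, IsIdempotentElem (s ^ omegaExp M) := by
  have key : ∀ s : M, ∃ n, 0 < n ∧ IsIdempotentElem (s ^ n) := by
    intro s
    obtain ⟨i, j, hij, h⟩ : ∃ i j : ℕ, i < j ∧ s ^ i = s ^ j := by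
      obtain ⟨i, j, hne, h⟩ := Finite.exists_ne_map_eq_of_infinite (fun n : ℕ => s ^ n)
      rcases lt_or_gt_of_ne hne with h' | h'
      · exact ⟨i, j, h', h⟩
      · exact ⟨j, i, h', h.symm⟩
    obtain ⟨p, hp, rfl⟩ : ∃ p, 0 < p ∧ j = i + p := ⟨j - i, by omega, by omega⟩
    have step : ∀ k m : ℕ, i ≤ k → s ^ (k + m * p) = s ^ k := by
      intro k m hk
      induction m with
      | zero => simp
      | succ m ih =>
        have e : k + (m + 1) * p = (i + p) + (k - i + m * p) := by
          have : (m + 1) * p = m * p + p := by ring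
          omega
        have e' : k + m * p = i + (k - i + m * p) := by omega
        rw [e, pow_add, ← h, ← pow_add, ← e', ih]
    refine ⟨(i + 1) * p, by positivity, ?_⟩
    change _ * _ = _
    rw [← pow_add]
    exact step _ _ (by nlinarith)
  choose n hn hidem using key
  have := Fintype.ofFinite M
  refine Nat.sInf_mem (s := {n | 0 < n ∧ ∀ s : M, IsIdempotentElem (s ^ n)})
    ⟨∏ s : M, n s, Finset.prod_pos fun s _ => hn s, fun s => ?_⟩
  obtain ⟨k, hk⟩ := Finset.dvd_prod_of_mem n (Finset.mem_univ s)
  rw [hk, pow_mul]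
  exact (hidem s).pow k

/-- A set of pairs is saturated for `ρ` (with respect to the star-free closure of `C`). -/
structure IsSaturated [IdemSemiring R] (C : Set (Language A))
    (hC : IsQuotientClosedBooleanAlgebra C) (ρ : MultiplicativeRatingMap A R)
    (S : Set (Classes C hC × R)) : Prop where
  trivial_mem : ∀ w : List A, (classOf C hC w, ρ ({w} : Language A)) ∈ S
  downset : ∀ (c : Classes C hC) (r q : R), (c, r) ∈ S → q ≤ r → (c, q) ∈ S
  mul_mem : ∀ (c d : Classes C hC) (q r : R), (c, q) ∈ S → (d, r) ∈ S → (c * d, q * r) ∈ S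
  closure_mem : ∀ (e : Classes C hC) (r : R), (e, r) ∈ S → IsIdempotentElem e →
    (e, r ^ omegaExp R + r ^ (omegaExp R + 1)) ∈ S

end StarFree

namespace StarFree

/-! Closure properties of star-free closures -/

section Closure

variable {A : Type*} {C : Set (Language A)}

/-! The imprint is saturated because finitely many languages of `SF(C)` are always saturated by one
congruence of finite index whose classes are in `SF(C)`, and for which `u ^ m` and `u ^ (m + 1)` are
equivalent for large `m` whenever the `∼`-class of `u` is idempotent
(`exists_isStarFreeCon_forall_saturates`). Lower bounds on the ratings of such classes multiply, and
aperiodicity puts `r ^ ω` and `r ^ (ω + 1)` below the rating of one and the same class.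

It is least because a saturated set `S` is a submonoid of `Q × R`, where `Q` is the quotient of `A*`
by `∼`. It suffices to partition `A*` into finitely many languages of `SF(C)`, each with some `t ∈
S` such that its words all have class `t.1` and rating at most `t.2`; niceness passes from words to
languages.

This partition is built for words read after a left multiplier `s` (finally `s = 1`), by induction
on the size of `s S` and then on the number of letters. If all letters act injectively on `s S` by
right multiplication, they permute it, and all words with the same first component are dominated
together (`HasDominatedPartition.of_injective`). Otherwise some letter `c` is not injective. Words
are cut after each `c`: the pieces without `c` use a smaller alphabet, and the blocks become letters
in `S c ∪ {1}`, whose orbit under the multiplier `s c` is smaller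
(`HasDominatedPartition.of_block`). -/

theorem starFreeClosure_congr {L K : Language A} (hL : L ∈ starFreeClosure C)
    (h : ∀ w, w ∈ K ↔ w ∈ L) : K ∈ starFreeClosure C := by
  rwa [Language.ext (m := L) h]

theorem mem_starFreeClosure_or {p q : List A → Prop} (hp : {w | p w} ∈ starFreeClosure C)
    (hq : {w | q w} ∈ starFreeClosure C) : {w | p w ∨ q w} ∈ starFreeClosure C :=
  starFreeClosure.union _ _ hp hq

theorem mem_starFreeClosure_and {p q : List A → Prop} (hp : {w | p w} ∈ starFreeClosure C)
    (hq : {w | q w} ∈ starFreeClosure C) : {w | p w ∧ q w} ∈ starFreeClosure C :=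
  starFreeClosure.inter _ _ hp hq

theorem mem_starFreeClosure_not {p : List A → Prop} (hp : {w | p w} ∈ starFreeClosure C) :
    {w | ¬ p w} ∈ starFreeClosure C :=
  starFreeClosure.compl _ hp

theorem mem_starFreeClosure_append {p q : List A → Prop} (hp : {w | p w} ∈ starFreeClosure C)
    (hq : {w | q w} ∈ starFreeClosure C) :
    {w | ∃ u v, p u ∧ q v ∧ w = u ++ v} ∈ starFreeClosure C := by
  refine starFreeClosure_congr (starFreeClosure.concat _ _ hp hq) fun w => ?_
  refine Iff.trans ?_ Language.mem_mul.symm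
  constructor
  · rintro ⟨u, v, hu, hv, rfl⟩
    exact ⟨u, hu, v, hv, rfl⟩
  · rintro ⟨u, hu, v, hv, rfl⟩
    exact ⟨u, v, hu, hv, rfl⟩

theorem mem_starFreeClosure_true (hC : (⊤ : Language A) ∈ C) (p : Prop) :
    {_w : List A | p} ∈ starFreeClosure C := by
  by_cases hp : p
  · exact starFreeClosure_congr (.base _ hC) fun w => iff_of_true hp (Set.mem_univ w)
  · exact starFreeClosure_congr (.compl _ (.base _ hC)) fun w =>
      iff_of_false hp fun h => h (Set.mem_univ w)

theorem mem_starFreeClosure_exists {ι : Type*} [Finite ι] (hC : (⊤ : Language A) ∈ C)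
    {p : ι → List A → Prop} (hp : ∀ i, {w | p i w} ∈ starFreeClosure C) :
    {w | ∃ i, p i w} ∈ starFreeClosure C := by
  have := Fintype.ofFinite ι
  have key : ∀ s : Finset ι, {w | ∃ i ∈ s, p i w} ∈ starFreeClosure C := by
    classical
    intro s
    induction s using Finset.induction_on with
    | empty => simpa using mem_starFreeClosure_true hC False
    | insert i s _ ih =>
      have := mem_starFreeClosure_or (hp i) ih
      simpa using this
  simpa using key Finset.univ

theorem mem_starFreeClosure_forall {ι : Type*} [Finite ι] (hC : (⊤ : Language A) ∈ C)
    {p : ι → List A → Prop} (hp : ∀ i, {w | p i w} ∈ starFreeClosure C) :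
    {w | ∀ i, p i w} ∈ starFreeClosure C := by
  have := mem_starFreeClosure_not
    (mem_starFreeClosure_exists hC fun i => mem_starFreeClosure_not (hp i))
  simpa using this

theorem mem_starFreeClosure_letter (a : A) : {w : List A | w = [a]} ∈ starFreeClosure C :=
  starFreeClosure.letter a

/-- Avoiding a letter `a` is the complement of `A* a A*`, and there are finitely many letters to
avoid. Sub-alphabet stars are the only stars that the construction needs. -/
theorem mem_starFreeClosure_forall_mem [Finite A] (hC : (⊤ : Language A) ∈ C) (D : Set A) :
    {w : List A | ∀ a ∈ w, a ∈ D} ∈ starFreeClosure C := by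
  have h : ∀ a : A, {w : List A | a ∈ w → a ∈ D} ∈ starFreeClosure C := by
    intro a
    by_cases ha : a ∈ D
    · simpa [ha] using mem_starFreeClosure_true hC True
    · have h1 := mem_starFreeClosure_not (mem_starFreeClosure_append
        (mem_starFreeClosure_true hC True)
        (mem_starFreeClosure_append (mem_starFreeClosure_letter a)
          (mem_starFreeClosure_true hC True)))
      refine starFreeClosure_congr h1 fun w => ?_
      change (a ∈ w → a ∈ D) ↔ ¬ _
      rw [imp_iff_not ha, List.mem_iff_append]
      simp
  exact mem_starFreeClosure_forall hC h

theorem mem_starFreeClosure_nil [Finite A] (hC : (⊤ : Language A) ∈ C) :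
    {w : List A | w = []} ∈ starFreeClosure C := by
  have := mem_starFreeClosure_forall_mem hC (∅ : Set A)
  refine starFreeClosure_congr this fun w => ?_
  change w = [] ↔ ∀ a ∈ w, a ∈ (∅ : Set A)
  rw [List.eq_nil_iff_forall_not_mem]
  rfl

theorem mem_starFreeClosure_eq [Finite A] (hC : (⊤ : Language A) ∈ C) (u : List A) :
    {w : List A | w = u} ∈ starFreeClosure C := by
  induction u with
  | nil => exact mem_starFreeClosure_nil hC
  | cons a u ih =>
    have := mem_starFreeClosure_append (mem_starFreeClosure_letter a) ih
    simpa using this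

theorem starFreeClosure_mono {C' : Set (Language A)} (h : C ⊆ starFreeClosure C') :
    starFreeClosure C ⊆ starFreeClosure C' := by
  intro L hL
  induction hL with
  | base L hL => exact h hL
  | letter a => exact .letter a
  | union K L _ _ hK hL => exact .union K L hK hL
  | inter K L _ _ hK hL => exact .inter K L hK hL
  | compl L _ hL => exact .compl L hL
  | concat K L _ _ hK hL => exact .concat K L hK hL

end Closure

/-! The canonical congruence -/

section Canonical

variable {A : Type*} {C : Set (Language A)} {hC : IsQuotientClosedBooleanAlgebra C}

theorem finite_classes (hC : IsQuotientClosedBooleanAlgebra C) (hfin : C.Finite) :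
    Finite (Classes C hC) := by
  have : Finite C := hfin
  let f : Classes C hC → Set C := fun c => {L | c.out.toList ∈ L.1}
  refine Finite.of_injective f fun c d h => ?_
  rw [← Quotient.out_eq c, ← Quotient.out_eq d]
  refine Quotient.sound fun L hL => ?_
  have : (⟨L, hL⟩ : C) ∈ f c ↔ ⟨L, hL⟩ ∈ f d := by rw [h]
  exact this

theorem classOf_eq_iff {u v : List A} :
    classOf C hC u = classOf C hC v ↔ ∀ L ∈ C, u ∈ L ↔ v ∈ L :=
  Con.eq (canonicalCon C hC)

theorem exists_classOf (c : Classes C hC) : ∃ w, classOf C hC w = c := by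
  obtain ⟨w, rfl⟩ := Quotient.exists_rep c
  exact ⟨w, rfl⟩

theorem mem_starFreeClosure_classOf (hfin : C.Finite) (c : Classes C hC) :
    {w | classOf C hC w = c} ∈ starFreeClosure C := by
  have : Finite C := hfin
  obtain ⟨u, rfl⟩ := exists_classOf c
  have h : ∀ L : C, {w : List A | w ∈ L.1 ↔ u ∈ L.1} ∈ starFreeClosure C := by
    intro L
    by_cases hu : u ∈ L.1
    · simp only [hu, iff_true]
      exact starFreeClosure.base _ L.2
    · simp only [hu, iff_false]
      exact starFreeClosure.compl _ (starFreeClosure.base _ L.2)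
  refine starFreeClosure_congr (mem_starFreeClosure_forall hC.univ_mem h) fun w => ?_
  exact classOf_eq_iff.trans ⟨fun h L => h L.1 L.2, fun h L hL => h ⟨L, hL⟩⟩

end Canonical

/-! Star-free congruences -/

theorem coe_pow_con {M : Type*} [Monoid M] (c : Con M) (u : M) (n : ℕ) :
    ((u ^ n : M) : c.Quotient) = (u : c.Quotient) ^ n :=
  map_pow c.mk' u n

theorem freeMonoid_mul_eq_mul {A : Type*} {u v w x : FreeMonoid A} (h : u * v = w * x) :
    (∃ y, w = u * y ∧ v = y * x) ∨ ∃ y, u = w * y ∧ x = y * v :=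
  List.append_eq_append_iff.1 h

section StarFreeCon

variable {A : Type*} {C : Set (Language A)} {hC : IsQuotientClosedBooleanAlgebra C}

/-- A congruence of finite index whose classes are in the star-free closure of `C`, and which is
aperiodic on the words whose class is idempotent. -/
structure IsStarFreeCon (C : Set (Language A)) (hC : IsQuotientClosedBooleanAlgebra C)
    (c : Con (FreeMonoid A)) : Prop where
  finite : Finite c.Quotient
  class_mem : ∀ q : c.Quotient, {w | ((FreeMonoid.ofList w : FreeMonoid A) : c.Quotient) = q} ∈
    starFreeClosure C
  aperiodic : ∃ n, ∀ m, n ≤ m → ∀ u : FreeMonoid A,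
    IsIdempotentElem (u : (canonicalCon C hC).Quotient) →
      (u : c.Quotient) ^ m = (u : c.Quotient) ^ (m + 1)

/-- A congruence saturates a language that is a union of classes. -/
def Saturates (c : Con (FreeMonoid A)) (L : Language A) : Prop :=
  ∀ u v : FreeMonoid A, (u : c.Quotient) = v → u.toList ∈ L → v.toList ∈ L

/-- Aperiodicity is immediate: the words to test are those whose class in this very quotient is
idempotent. -/
theorem isStarFreeCon_canonicalCon (hfin : C.Finite) :
    IsStarFreeCon C hC (canonicalCon C hC) where
  finite := finite_classes hC hfin
  class_mem q := mem_starFreeClosure_classOf hfin q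
  aperiodic := by
    refine ⟨1, fun m hm u hu => ?_⟩
    rw [hu.pow_eq (by omega), hu.pow_eq (by omega)]

theorem saturates_canonicalCon {L : Language A} (hL : L ∈ C) :
    Saturates (canonicalCon C hC) L := fun _ _ h hu =>
  ((Con.eq (canonicalCon C hC)).1 h L hL).1 hu

theorem IsStarFreeCon.inf {c d : Con (FreeMonoid A)} (hc : IsStarFreeCon C hC c)
    (hd : IsStarFreeCon C hC d) : IsStarFreeCon C hC (c ⊓ d) where
  finite := by
    have := hc.finite
    have := hd.finite
    let f : (c ⊓ d).Quotient → c.Quotient × d.Quotient := fun q =>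
      (Con.map (c ⊓ d) c inf_le_left q, Con.map (c ⊓ d) d inf_le_right q)
    refine Finite.of_injective f fun x y h => ?_
    obtain ⟨u, rfl⟩ := Quotient.exists_rep x
    obtain ⟨v, rfl⟩ := Quotient.exists_rep y
    exact (Con.eq _).2 (Con.inf_iff_and.2 ⟨(Con.eq c).1 (congrArg Prod.fst h),
      (Con.eq d).1 (congrArg Prod.snd h)⟩)
  class_mem q := by
    obtain ⟨u, rfl⟩ := Quotient.exists_rep q
    refine starFreeClosure_congr (mem_starFreeClosure_and (hc.class_mem u) (hd.class_mem u))
      fun w => ?_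
    exact ((Con.eq _).trans Con.inf_iff_and).trans (and_congr (Con.eq c).symm (Con.eq d).symm)
  aperiodic := by
    obtain ⟨n, hn⟩ := hc.aperiodic
    obtain ⟨k, hk⟩ := hd.aperiodic
    refine ⟨n + k, fun m hm u hu => ?_⟩
    rw [← coe_pow_con, ← coe_pow_con, Con.eq, Con.inf_iff_and, ← Con.eq, ← Con.eq]
    exact ⟨hn m (by omega) u hu, hk m (by omega) u hu⟩

theorem Saturates.inf_left {c d : Con (FreeMonoid A)} {L : Language A} (h : Saturates c L) :
    Saturates (c ⊓ d) L := fun u v huv =>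
  h u v ((Con.eq c).2 (Con.inf_iff_and.1 ((Con.eq _).1 huv)).1)

theorem Saturates.inf_right {c d : Con (FreeMonoid A)} {L : Language A} (h : Saturates d L) :
    Saturates (c ⊓ d) L := fun u v huv =>
  h u v ((Con.eq d).2 (Con.inf_iff_and.1 ((Con.eq _).1 huv)).2)

/-- The congruence that identifies all words of length at least two. -/
def shortWordCon (A : Type*) : Con (FreeMonoid A) where
  r u v := u = v ∨ 2 ≤ u.length ∧ 2 ≤ v.length
  iseqv := by
    refine ⟨fun _ => .inl rfl, ?_, ?_⟩
    · rintro u v (rfl | h)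
      · exact .inl rfl
      · exact .inr h.symm
    · rintro u v w (rfl | h) (rfl | h')
      · exact .inl rfl
      · exact .inr h'
      · exact .inr h
      · exact .inr ⟨h.1, h'.2⟩
  mul' := by
    intro u u' v v' h h'
    simp only [FreeMonoid.length_mul]
    rcases h with rfl | h
    · rcases h' with rfl | h'
      · exact .inl rfl
      · exact .inr (by omega)
    · exact .inr (by omega)

theorem isStarFreeCon_shortWordCon [Finite A] : IsStarFreeCon C hC (shortWordCon A) where
  finite := by
    have : Finite {l : List A // l.length < 2} := List.finite_length_lt A 2
    classical
    let f : (shortWordCon A).Quotient → Option {l : List A // l.length < 2} := fun q =>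
      if h : (q.out.toList).length < 2 then some ⟨_, h⟩ else none
    refine Finite.of_injective f fun x y h => ?_
    rw [← Quotient.out_eq x, ← Quotient.out_eq y]
    refine Quotient.sound ?_
    by_cases hx : (x.out.toList).length < 2 <;> by_cases hy : (y.out.toList).length < 2
    · simp only [f, dif_pos hx, dif_pos hy, Option.some.injEq, Subtype.mk.injEq] at h
      exact .inl h
    · simp only [f, dif_pos hx, dif_neg hy, reduceCtorEq] at h
    · simp only [f, dif_neg hx, dif_pos hy, reduceCtorEq] at h
    · exact .inr ⟨not_lt.1 hx, not_lt.1 hy⟩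
  class_mem q := by
    obtain ⟨u, rfl⟩ := Quotient.exists_rep q
    have hlong : {w : List A | 2 ≤ w.length} ∈ starFreeClosure C := by
      have := mem_starFreeClosure_not (mem_starFreeClosure_or
        (mem_starFreeClosure_nil hC.univ_mem)
        (mem_starFreeClosure_exists hC.univ_mem mem_starFreeClosure_letter))
      refine starFreeClosure_congr this fun w => ?_
      change 2 ≤ w.length ↔ ¬ (w = [] ∨ ∃ i, w = [i])
      rw [← List.length_eq_one_iff, ← List.length_eq_zero_iff]
      omega
    refine starFreeClosure_congr (mem_starFreeClosure_or
      (mem_starFreeClosure_eq hC.univ_mem u.toList)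
      (mem_starFreeClosure_and hlong
        (mem_starFreeClosure_true hC.univ_mem (2 ≤ u.toList.length)))) fun w => ?_
    exact Con.eq _
  aperiodic := by
    -- Powers of a nonempty word from the square on have length at least two; powers of the empty
    -- word are all equal.
    refine ⟨2, fun m hm u _ => ?_⟩
    rw [← coe_pow_con, ← coe_pow_con, Con.eq]
    have hlen : ∀ k, (u ^ k).length = k * u.length := by
      intro k
      induction k with
      | zero => simp
      | succ k ih => rw [pow_succ, FreeMonoid.length_mul, ih]; ring
    rcases Nat.eq_zero_or_pos u.length with h0 | h0
    · rw [FreeMonoid.length_eq_zero] at h0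
      subst h0
      exact .inl (by simp)
    · refine .inr ⟨?_, ?_⟩ <;> rw [hlen] <;> nlinarith

theorem saturates_shortWordCon (a : A) : Saturates (shortWordCon A) ({[a]} : Language A) := by
  intro u v h hu
  change u.toList = [a] at hu
  rcases (Con.eq _).1 h with rfl | h
  · exact hu
  · have := congrArg List.length hu
    have h' : 2 ≤ u.toList.length := h.1
    simp at this
    omega

/-- The pairs of classes of the factorizations of a word into two words. -/
def factorizations (c : Con (FreeMonoid A)) (w : FreeMonoid A) : Set (c.Quotient × c.Quotient) :=
  {p | ∃ u v : FreeMonoid A, w = u * v ∧ p = ((u : c.Quotient), (v : c.Quotient))}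

/-- A cut of `w * w'` falls inside one factor, and the class of the other is the product of the
entries of any of its pairs. So the set for the product depends only on the sets for the factors,
which makes `factorizationCon` a congruence. -/
theorem factorizations_mul (c : Con (FreeMonoid A)) (w w' : FreeMonoid A) :
    factorizations c (w * w') = {p | ∃ a ∈ factorizations c w, ∃ b ∈ factorizations c w',
      p = (a.1, a.2 * (b.1 * b.2)) ∨ p = (a.1 * a.2 * b.1, b.2)} := by
  ext p
  constructor
  · rintro ⟨u, v, h, rfl⟩
    rcases freeMonoid_mul_eq_mul h with ⟨x, rfl, h2⟩ | ⟨x, h1, rfl⟩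
    · exact ⟨_, ⟨w, 1, (mul_one w).symm, rfl⟩, _, ⟨x, v, h2, rfl⟩, .inr (by simp)⟩
    · exact ⟨_, ⟨u, x, h1, rfl⟩, _, ⟨1, w', (one_mul w').symm, rfl⟩, .inl (by simp)⟩
  · rintro ⟨_, ⟨u, v, rfl, rfl⟩, _, ⟨u', v', rfl, rfl⟩, rfl | rfl⟩
    · exact ⟨u, v * (u' * v'), by simp only [mul_assoc], rfl⟩
    · exact ⟨u * v * u', v', by simp only [mul_assoc], rfl⟩

/-- The congruence of the words with the same pairs of classes of factorizations. -/
def factorizationCon (c : Con (FreeMonoid A)) : Con (FreeMonoid A) where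
  r u v := factorizations c u = factorizations c v
  iseqv := ⟨fun _ => rfl, fun h => h.symm, fun h h' => h.trans h'⟩
  mul' := by
    intro u u' v v' h h'
    rw [factorizations_mul, factorizations_mul, h, h']

theorem exists_of_pow_eq_mul {u : FreeMonoid A} {m : ℕ} {x y : FreeMonoid A}
    (h : u ^ (m + 1) = x * y) :
    ∃ i j a b, i + j = m ∧ u = a * b ∧ x = u ^ i * a ∧ y = b * u ^ j := by
  induction m generalizing x with
  | zero =>
    exact ⟨0, 0, x, y, rfl, by simpa using h, by simp, by simp⟩
  | succ m ih =>
    rw [pow_succ'] at h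
    rcases freeMonoid_mul_eq_mul h with ⟨z, h1, h2⟩ | ⟨z, h1, h2⟩
    · obtain ⟨i, j, a, b, hij, hu, hz, hy⟩ := ih h2
      exact ⟨i + 1, j, a, b, by omega, hu, by rw [pow_succ', mul_assoc, ← hz, h1], hy⟩
    · exact ⟨0, m + 1, x, z, by omega, h1, by simp, h2⟩

theorem IsStarFreeCon.factorizationCon {c : Con (FreeMonoid A)} (hc : IsStarFreeCon C hC c) :
    IsStarFreeCon C hC (factorizationCon c) where
  finite := by
    have := hc.finite
    let f : (StarFree.factorizationCon c).Quotient → Set (c.Quotient × c.Quotient) := fun q =>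
      factorizations c q.out
    refine Finite.of_injective f fun x y h => ?_
    rw [← Quotient.out_eq x, ← Quotient.out_eq y]
    exact Quotient.sound h
  class_mem q := by
    have := hc.finite
    obtain ⟨u, rfl⟩ := Quotient.exists_rep q
    have h : ∀ p : c.Quotient × c.Quotient, {w : List A |
        p ∈ factorizations c (FreeMonoid.ofList w) ↔ p ∈ factorizations c u} ∈
          starFreeClosure C := by
      intro p
      have hp : {w : List A | p ∈ factorizations c (FreeMonoid.ofList w)} ∈
          starFreeClosure C := by
        refine starFreeClosure_congr (mem_starFreeClosure_append (hc.class_mem p.1)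
          (hc.class_mem p.2)) fun w => ?_
        constructor
        · rintro ⟨x, y, h, rfl⟩
          exact ⟨x, y, rfl, rfl, h⟩
        · rintro ⟨x, y, hx, hy, h⟩
          exact ⟨x, y, h, Prod.ext hx.symm hy.symm⟩
      by_cases hu : p ∈ factorizations c u
      · simpa [hu] using hp
      · simpa [hu] using mem_starFreeClosure_not hp
    refine starFreeClosure_congr (mem_starFreeClosure_forall hC.univ_mem h) fun w => ?_
    exact (Con.eq _).trans Set.ext_iff
  aperiodic := by
    obtain ⟨n, hn⟩ := hc.aperiodic
    -- A cut breaks one copy of `u`. Among the remaining copies, at least `2 * n` in number, one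
    -- side has `n` or more, so a copy can be added there; for the larger power one side has at
    -- least `n + 1`, so a copy can be removed.
    refine ⟨2 * n + 1, fun m hm u hu => ?_⟩
    rw [← coe_pow_con, ← coe_pow_con, Con.eq]
    obtain ⟨m, rfl⟩ : ∃ k, m = k + 1 := ⟨m - 1, by omega⟩
    change factorizations c _ = factorizations c _
    ext p
    constructor
    · rintro ⟨x, y, h, rfl⟩
      obtain ⟨i, j, a, b, hij, hab, rfl, rfl⟩ := exists_of_pow_eq_mul h
      by_cases hi : n ≤ i
      · refine ⟨u ^ (i + 1) * a, b * u ^ j, ?_, ?_⟩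
        · rw [mul_assoc, ← mul_assoc a, ← hab, ← pow_succ', ← pow_add]
          congr 1
          omega
        · simp [Con.coe_mul, coe_pow_con, hn i hi u hu]
      · refine ⟨u ^ i * a, b * u ^ (j + 1), ?_, ?_⟩
        · rw [mul_assoc, ← mul_assoc a, ← hab, ← pow_succ', ← pow_add]
          congr 1
          omega
        · simp [Con.coe_mul, coe_pow_con, hn j (by omega) u hu]
    · rintro ⟨x, y, h, rfl⟩
      obtain ⟨i, j, a, b, hij, hab, rfl, rfl⟩ := exists_of_pow_eq_mul h
      by_cases hi : n + 1 ≤ i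
      · obtain ⟨i, rfl⟩ : ∃ k, i = k + 1 := ⟨i - 1, by omega⟩
        refine ⟨u ^ i * a, b * u ^ j, ?_, ?_⟩
        · rw [mul_assoc, ← mul_assoc a, ← hab, ← pow_succ', ← pow_add]
          congr 1
          omega
        · simp [Con.coe_mul, coe_pow_con, hn i (by omega) u hu]
      · obtain ⟨j, rfl⟩ : ∃ k, j = k + 1 := ⟨j - 1, by omega⟩
        refine ⟨u ^ i * a, b * u ^ j, ?_, ?_⟩
        · rw [mul_assoc, ← mul_assoc a, ← hab, ← pow_succ', ← pow_add]
          congr 1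
          omega
        · simp [Con.coe_mul, coe_pow_con, hn j (by omega) u hu]

theorem Saturates.mul {c : Con (FreeMonoid A)} {K L : Language A} (hK : Saturates c K)
    (hL : Saturates c L) : Saturates (factorizationCon c) (K * L) := by
  intro u v h hu
  obtain ⟨x, hx, y, hy, hxy⟩ := Language.mem_mul.1 hu
  have hp : ((FreeMonoid.ofList x : c.Quotient), (FreeMonoid.ofList y : c.Quotient)) ∈
      factorizations c v := by
    rw [← show factorizations c u = factorizations c v from (Con.eq _).1 h]
    exact ⟨_, _, hxy.symm, rfl⟩
  obtain ⟨x', y', hv, hp⟩ := hp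
  rw [Prod.mk.injEq] at hp
  exact Language.mem_mul.2 ⟨_, hK _ _ hp.1 hx, _, hL _ _ hp.2 hy, hv.symm⟩

theorem exists_isStarFreeCon_saturates [Finite A] (hC : IsQuotientClosedBooleanAlgebra C)
    (hfin : C.Finite) {L : Language A} (hL : L ∈ starFreeClosure C) :
    ∃ c, IsStarFreeCon C hC c ∧ Saturates c L := by
  induction hL with
  | base L hL => exact ⟨_, isStarFreeCon_canonicalCon hfin, saturates_canonicalCon hL⟩
  | letter a => exact ⟨_, isStarFreeCon_shortWordCon, saturates_shortWordCon a⟩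
  | union K L _ _ hK hL =>
    obtain ⟨c, hc, hcK⟩ := hK
    obtain ⟨d, hd, hdL⟩ := hL
    exact ⟨c ⊓ d, hc.inf hd, fun u v h =>
      Or.imp (hcK.inf_left u v h) (hdL.inf_right u v h)⟩
  | inter K L _ _ hK hL =>
    obtain ⟨c, hc, hcK⟩ := hK
    obtain ⟨d, hd, hdL⟩ := hL
    exact ⟨c ⊓ d, hc.inf hd, fun u v h =>
      And.imp (hcK.inf_left u v h) (hdL.inf_right u v h)⟩
  | compl L _ hL =>
    obtain ⟨c, hc, hcL⟩ := hL
    exact ⟨c, hc, fun u v h => mt (hcL v u h.symm)⟩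
  | concat K L _ _ hK hL =>
    obtain ⟨c, hc, hcK⟩ := hK
    obtain ⟨d, hd, hdL⟩ := hL
    exact ⟨_, (hc.inf hd).factorizationCon, hcK.inf_left.mul hdL.inf_right⟩

theorem exists_isStarFreeCon_forall_saturates [Finite A] (hC : IsQuotientClosedBooleanAlgebra C)
    (hfin : C.Finite) {K : Set (Language A)} (hK : K.Finite) (hKC : K ⊆ starFreeClosure C) :
    ∃ c, IsStarFreeCon C hC c ∧ ∀ L ∈ K, Saturates c L := by
  induction K, hK using Set.Finite.induction_on with
  | empty => exact ⟨_, isStarFreeCon_canonicalCon hfin, by simp⟩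
  | insert _ _ ih =>
    rw [Set.insert_subset_iff] at hKC
    obtain ⟨c, hc, hcK⟩ := exists_isStarFreeCon_saturates hC hfin hKC.1
    obtain ⟨d, hd, hdL⟩ := ih hKC.2
    refine ⟨c ⊓ d, hc.inf hd, ?_⟩
    rintro L (rfl | hL)
    · exact hcK.inf_left
    · exact (hdL L hL).inf_right

end StarFreeCon

/-! The pointed optimal imprint is saturated -/

section Soundness

variable {A R : Type*} [IdemSemiring R] {C : Set (Language A)}
  {hC : IsQuotientClosedBooleanAlgebra C} {ρ : MultiplicativeRatingMap A R}

theorem ratingMap_mono (ρ : MultiplicativeRatingMap A R) {H H' : Language A}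
    (h : ∀ w, w ∈ H → w ∈ H') : ρ H ≤ ρ H' := by
  have h' : H + H' = H' := Set.union_eq_right.2 h
  rw [← add_eq_right_iff_le, ← map_add, h']

theorem mem_optimalImprint_iff [Finite R] {D : Set (Language A)} (hD : IsBooleanAlgebra D)
    {L : Language A} {r : R} :
    r ∈ optimalImprint D L ρ ↔ ∀ K, IsCover D L K → r ∈ imprint ρ K := by
  constructor
  · rintro ⟨K, hK, hr⟩ K' hK'
    exact hK.2 K' hK' hr
  · intro h
    obtain ⟨K, hK⟩ := exists_isOptimalCover hD L ρ
    exact ⟨K, hK, h K hK.1⟩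

/-- A class of a congruence, viewed as a language. -/
def conLanguage {c : Con (FreeMonoid A)} (q : c.Quotient) : Language A :=
  {w : List A | ((FreeMonoid.ofList w : FreeMonoid A) : c.Quotient) = q}

theorem ratingMap_mul_conLanguage_le {c : Con (FreeMonoid A)} (q q' : c.Quotient) :
    ρ (conLanguage q) * ρ (conLanguage q') ≤ ρ (conLanguage (q * q')) := by
  rw [← map_mul]
  refine ratingMap_mono ρ fun w hw => ?_
  obtain ⟨x, hx, y, hy, rfl⟩ := Language.mem_mul.1 hw
  exact congrArg₂ (· * ·) hx hy

theorem ratingMap_pow_conLanguage_le {c : Con (FreeMonoid A)} (q : c.Quotient) (n : ℕ) :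
    ρ (conLanguage q) ^ n ≤ ρ (conLanguage (q ^ n)) := by
  induction n with
  | zero =>
    rw [pow_zero, pow_zero, ← map_one ρ]
    refine ratingMap_mono ρ fun w hw => ?_
    rw [Language.mem_one] at hw
    subst hw
    rfl
  | succ n ih =>
    rw [pow_succ, pow_succ]
    exact (mul_le_mul_left ih _).trans (ratingMap_mul_conLanguage_le _ _)

/-- The classes of `c` that meet `L` form a cover of `L`. -/
theorem exists_le_conLanguage [Finite R] {L : Language A} {r : R}
    (hr : r ∈ optimalImprint (starFreeClosure C) L ρ) (hC : IsQuotientClosedBooleanAlgebra C)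
    {c : Con (FreeMonoid A)} (hc : IsStarFreeCon C hC c) :
    ∃ u ∈ L, r ≤ ρ (conLanguage ((FreeMonoid.ofList u : FreeMonoid A) : c.Quotient)) := by
  have := hc.finite
  rw [mem_optimalImprint_iff (isBooleanAlgebra_starFreeClosure hC.toIsBooleanAlgebra)] at hr
  obtain ⟨_, ⟨u, hu, rfl⟩, h⟩ := hr
    ((fun u : List A => conLanguage ((FreeMonoid.ofList u : FreeMonoid A) : c.Quotient)) ''
      {w | w ∈ L}) (by
    refine ⟨(Set.finite_range (conLanguage (c := c))).subset ?_, ?_, ?_⟩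
    · rintro _ ⟨u, _, rfl⟩
      exact ⟨_, rfl⟩
    · rintro _ ⟨u, _, rfl⟩
      exact hc.class_mem _
    · intro w hw
      exact ⟨_, ⟨w, hw, rfl⟩, rfl⟩)
  exact ⟨u, hu, h⟩

theorem le_of_saturates {c : Con (FreeMonoid A)} {H : Language A} (hH : Saturates c H)
    {u : FreeMonoid A} (hu : u.toList ∈ H) : ρ (conLanguage (u : c.Quotient)) ≤ ρ H :=
  ratingMap_mono ρ fun w hw => hH u (FreeMonoid.ofList w) hw.symm hu

theorem isSaturated_pointedOptimalImprint [Finite A] [Finite R]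
    (hC : IsQuotientClosedBooleanAlgebra C) (hfin : C.Finite)
    (ρ : MultiplicativeRatingMap A R) :
    IsSaturated C hC ρ (pointedOptimalImprint C hC ρ) := by
  have hiff : ∀ (c : Classes C hC) (r : R), (c, r) ∈ pointedOptimalImprint C hC ρ ↔
      ∀ K, IsCover (starFreeClosure C) (classLanguage c) K → r ∈ imprint ρ K := fun c r =>
    mem_optimalImprint_iff (isBooleanAlgebra_starFreeClosure hC.toIsBooleanAlgebra)
  refine ⟨fun w => ?_, fun c r q hr hqr => ?_, fun c d q r hq hr => ?_, fun e r hr he => ?_⟩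
  · rw [hiff]
    rintro K ⟨-, -, hK⟩
    obtain ⟨H, hH, hw⟩ := hK w rfl
    refine ⟨H, hH, ratingMap_mono ρ fun v hv => ?_⟩
    obtain rfl : v = w := hv
    exact hw
  · rw [hiff] at hr ⊢
    intro K hK
    obtain ⟨H, hH, h⟩ := hr K hK
    exact ⟨H, hH, hqr.trans h⟩
  · rw [hiff]
    rintro K ⟨hKfin, hKC, hK⟩
    obtain ⟨κ, hκ, hsat⟩ := exists_isStarFreeCon_forall_saturates hC hfin hKfin hKC
    obtain ⟨u, hu, hq⟩ := exists_le_conLanguage hq hC hκ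
    obtain ⟨v, hv, hr⟩ := exists_le_conLanguage hr hC hκ
    obtain ⟨H, hH, hw⟩ := hK (u ++ v) (congrArg₂ (· * ·) hu hv)
    exact ⟨H, hH, (mul_le_mul' hq hr).trans
      ((ratingMap_mul_conLanguage_le _ _).trans (le_of_saturates (hsat H hH) hw))⟩
  · rw [hiff]
    rintro K ⟨hKfin, hKC, hK⟩
    obtain ⟨κ, hκ, hsat⟩ := exists_isStarFreeCon_forall_saturates hC hfin hKfin hKC
    obtain ⟨u, hu, hr⟩ := exists_le_conLanguage hr hC hκ
    obtain ⟨n, hn⟩ := hκ.aperiodic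
    have hu' : ((FreeMonoid.ofList u : FreeMonoid A) : (canonicalCon C hC).Quotient) = e := hu
    obtain ⟨hω, hidem⟩ := omegaExp_spec R
    set w : FreeMonoid A := FreeMonoid.ofList u with hw_def
    set ω := omegaExp R
    -- A multiple of `ω`, so that `r ^ m = r ^ ω`, and at least `n`, so that `w ^ m` and `w ^ (m +
    -- 1)` are equivalent for `κ`.
    set m := ω * (n + 1) with hm
    have hnm : n ≤ m := by nlinarith
    have hm0 : m ≠ 0 := by positivity
    have hrm : r ^ m = r ^ ω := by
      rw [hm, pow_mul]
      exact (hidem r).pow_eq (by omega)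
    have hwm : (w : κ.Quotient) ^ m = (w : κ.Quotient) ^ (m + 1) := hn m hnm w (hu' ▸ he)
    obtain ⟨H, hH, hwH⟩ := hK (w ^ m).toList (by
      change ((w ^ m : FreeMonoid A) : (canonicalCon C hC).Quotient) = e
      rw [coe_pow_con, hu', he.pow_eq hm0])
    have hle : ρ (conLanguage ((w : κ.Quotient) ^ m)) ≤ ρ H := by
      rw [← coe_pow_con]
      exact le_of_saturates (hsat H hH) hwH
    refine ⟨H, hH, add_le ?_ ?_⟩
    · rw [← hrm]
      exact (pow_le_pow_left' hr m).trans ((ratingMap_pow_conLanguage_le _ _).trans hle)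
    · rw [pow_succ, ← hrm, ← pow_succ]
      rw [hwm] at hle
      exact (pow_le_pow_left' hr (m + 1)).trans ((ratingMap_pow_conLanguage_le _ _).trans hle)

end Soundness

/-! Decompositions of words into blocks ending with a given letter -/

section Blocks

variable {B Γ : Type*}

/-- `w` is a word over the set `D` of letters. -/
def IsOver (D : Set B) (w : List B) : Prop := ∀ b ∈ w, b ∈ D

theorem IsOver.append {D : Set B} {u v : List B} (hu : IsOver D u) (hv : IsOver D v) :
    IsOver D (u ++ v) := fun b hb => (List.mem_append.1 hb).elim (hu b) (hv b)

theorem IsOver.cons {D : Set B} {b : B} {u : List B} (hb : b ∈ D) (hu : IsOver D u) :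
    IsOver D (b :: u) := List.forall_mem_cons.2 ⟨hb, hu⟩

theorem IsOver.mono {D D' : Set B} (h : D ⊆ D') {u : List B} (hu : IsOver D u) :
    IsOver D' u := fun b hb => h (hu b hb)

theorem isOver_nil (D : Set B) : IsOver D [] := fun _ hb => absurd hb List.not_mem_nil

/-- Both sides are cut at the first occurrence of `c`. -/
theorem append_cons_inj {D : Set B} {c : B} (hc : c ∉ D) {k k' v v' : List B} (hk : IsOver D k)
    (hk' : IsOver D k') (h : k ++ c :: v = k' ++ c :: v') : k = k' ∧ v = v' := by
  rcases List.append_eq_append_iff.1 h with ⟨l, h1, h2⟩ | ⟨l, h1, h2⟩ <;> cases l with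
  | nil => simp_all
  | cons b l =>
    rw [List.cons_append, List.cons.injEq] at h2
    obtain ⟨rfl, -⟩ := h2
    first
    | exact absurd (hk' c (by simp [h1])) hc
    | exact absurd (hk c (by simp [h1])) hc

/-- `BlockDecomposition c D γ v g`: the word `v` is a product of blocks `k c`, where `k` is over
`D`, and `g` is the word of the values `γ k`. -/
inductive BlockDecomposition (c : B) (D : Set B) (γ : List B → Γ) : List B → List Γ → Prop
  | nil : BlockDecomposition c D γ [] []
  | cons (k v : List B) (g : List Γ) (hk : IsOver D k) (hv : BlockDecomposition c D γ v g) :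
      BlockDecomposition c D γ (k ++ c :: v) (γ k :: g)

variable {c : B} {D : Set B} {γ : List B → Γ}

theorem BlockDecomposition.isOver {v : List B} {g : List Γ} (h : BlockDecomposition c D γ v g) :
    IsOver (insert c D) v := by
  induction h with
  | nil => exact isOver_nil _
  | cons k v g hk _ ih =>
    exact (hk.mono (Set.subset_insert c D)).append (ih.cons (Set.mem_insert c D))

theorem BlockDecomposition.append {v v' : List B} {g g' : List Γ}
    (h : BlockDecomposition c D γ v g) (h' : BlockDecomposition c D γ v' g') :
    BlockDecomposition c D γ (v ++ v') (g ++ g') := by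
  induction h with
  | nil => exact h'
  | cons k v g hk _ ih =>
    rw [List.append_assoc, List.cons_append, List.cons_append]
    exact .cons _ _ _ hk ih

theorem BlockDecomposition.exists_append {v : List B} {g g' : List Γ}
    (h : BlockDecomposition c D γ v (g ++ g')) :
    ∃ u u', BlockDecomposition c D γ u g ∧ BlockDecomposition c D γ u' g' ∧ v = u ++ u' := by
  induction g generalizing v with
  | nil => exact ⟨[], v, .nil, h, rfl⟩
  | cons x g ih =>
    rw [List.cons_append] at h
    cases h with
    | cons k v _ hk hv =>
      obtain ⟨u, u', hu, hu', rfl⟩ := ih hv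
      exact ⟨k ++ c :: u, u', .cons _ _ _ hk hu, hu', by simp⟩

theorem exists_blockDecomposition (γ : List B → Γ) {w : List B} (hw : IsOver (insert c D) w) :
    ∃ v g k, BlockDecomposition c D γ v g ∧ IsOver D k ∧ w = v ++ k := by
  induction w with
  | nil => exact ⟨[], [], [], .nil, isOver_nil D, rfl⟩
  | cons b w ih =>
    obtain ⟨hb, hw⟩ := List.forall_mem_cons.1 hw
    obtain ⟨v, g, k, hv, hk, rfl⟩ := ih hw
    rcases hb with rfl | hb
    · exact ⟨_, _, k, .cons [] v g (isOver_nil D) hv, hk, rfl⟩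
    -- A letter of `D` is absorbed by the first block, or by the final remainder if there is no
    -- block.
    · cases hv with
      | nil => exact ⟨_, _, b :: k, .nil, hk.cons hb, rfl⟩
      | cons k' v g hk' hv => exact ⟨_, _, k, .cons (b :: k') v g (hk'.cons hb) hv, hk, rfl⟩

theorem BlockDecomposition.unique (hc : c ∉ D) {v v' k k' : List B} {g g' : List Γ}
    (h : BlockDecomposition c D γ v g) (h' : BlockDecomposition c D γ v' g')
    (hk : IsOver D k) (hk' : IsOver D k') (heq : v ++ k = v' ++ k') :
    v = v' ∧ g = g' ∧ k = k' := by
  induction h generalizing v' g' with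
  | nil =>
    cases h' with
    | nil => exact ⟨rfl, rfl, heq⟩
    | cons l v' g' hl hv' => exact absurd (hk c (by rw [List.nil_append] at heq; simp [heq])) hc
  | cons l v g hl _ ih =>
    cases h' with
    | nil => exact absurd (hk' c (by rw [List.nil_append] at heq; simp [← heq])) hc
    | cons l' v' g' hl' hv' =>
      simp only [List.append_assoc, List.cons_append] at heq
      obtain ⟨rfl, heq'⟩ := append_cons_inj hc hl hl' heq
      obtain ⟨rfl, rfl, rfl⟩ := ih hv' heq'
      exact ⟨rfl, rfl, rfl⟩

/-- The language `(D* c)*` is rewritten without this outer star: apart from the empty word, it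
consists of the words over `D ∪ {c}` that end with `c`. -/
theorem exists_blockDecomposition_iff {v : List B} :
    (∃ g, BlockDecomposition c D γ v g) ↔
      v = [] ∨ ∃ u w, IsOver (insert c D) u ∧ w = [c] ∧ v = u ++ w := by
  constructor
  · rintro ⟨g, h⟩
    induction h with
    | nil => exact .inl rfl
    | cons k v g hk _ ih =>
      have hk' := hk.mono (Set.subset_insert c D)
      rcases ih with rfl | ⟨u, _, hu, rfl, rfl⟩
      · exact .inr ⟨k, _, hk', rfl, rfl⟩
      · exact .inr ⟨k ++ c :: u, _, hk'.append (hu.cons (Set.mem_insert c D)), rfl, by simp⟩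
  · rintro (rfl | ⟨u, _, hu, rfl, rfl⟩)
    · exact ⟨[], .nil⟩
    · obtain ⟨v, g, k, hv, hk, rfl⟩ := exists_blockDecomposition γ hu
      rw [List.append_assoc]
      exact ⟨_, hv.append (.cons k [] [] hk .nil)⟩

theorem mem_starFreeClosure_blockDecomposition [Finite B] {C : Set (Language B)}
    (hC : (⊤ : Language B) ∈ C) :
    {v | ∃ g, BlockDecomposition c D γ v g} ∈ starFreeClosure C := by
  simp only [exists_blockDecomposition_iff]
  exact mem_starFreeClosure_or (mem_starFreeClosure_nil hC) (mem_starFreeClosure_append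
    (mem_starFreeClosure_forall_mem hC _) (mem_starFreeClosure_letter c))

/-- Since `c ∉ D`, the block word is determined by `v`, so taking preimages commutes with
intersection and with complement relative to the decomposable words. Concatenation is preserved
because a cut of the block word lifts to a cut of `v`. -/
theorem mem_starFreeClosure_of_blockDecomposition [Finite B] {C : Set (Language B)}
    {C' : Set (Language Γ)} (hC : (⊤ : Language B) ∈ C) (hc : c ∉ D)
    (hbase : ∀ L ∈ C', {v | ∃ g ∈ L, BlockDecomposition c D γ v g} ∈ starFreeClosure C)
    (hletter : ∀ x, {k | IsOver D k ∧ γ k = x} ∈ starFreeClosure C)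
    {L : Language Γ} (hL : L ∈ starFreeClosure C') :
    {v | ∃ g ∈ L, BlockDecomposition c D γ v g} ∈ starFreeClosure C := by
  have huniq : ∀ {v g g'}, BlockDecomposition c D γ v g → BlockDecomposition c D γ v g' →
      g = g' := fun h h' => (h.unique hc h' (isOver_nil D) (isOver_nil D) rfl).2.1
  induction hL with
  | base L hL => exact hbase L hL
  | letter x =>
    refine starFreeClosure_congr (mem_starFreeClosure_append (hletter x)
      (mem_starFreeClosure_letter c)) fun v => ?_
    constructor
    · rintro ⟨g, hg, h⟩
      obtain rfl : g = [x] := hg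
      cases h with
      | cons k v _ hk hv =>
        cases hv
        exact ⟨k, _, ⟨hk, rfl⟩, rfl, rfl⟩
    · rintro ⟨k, _, ⟨hk, rfl⟩, rfl, rfl⟩
      exact ⟨[γ k], rfl, .cons k [] [] hk .nil⟩
  | union K L _ _ hK hL =>
    refine starFreeClosure_congr (mem_starFreeClosure_or hK hL) fun v => ?_
    constructor
    · rintro ⟨g, hg | hg, h⟩
      · exact .inl ⟨g, hg, h⟩
      · exact .inr ⟨g, hg, h⟩
    · rintro (⟨g, hg, h⟩ | ⟨g, hg, h⟩)
      · exact ⟨g, .inl hg, h⟩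
      · exact ⟨g, .inr hg, h⟩
  | inter K L _ _ hK hL =>
    refine starFreeClosure_congr (mem_starFreeClosure_and hK hL) fun v => ?_
    constructor
    · rintro ⟨g, hg, h⟩
      exact ⟨⟨g, hg.1, h⟩, ⟨g, hg.2, h⟩⟩
    · rintro ⟨⟨g, hg, h⟩, ⟨g', hg', h'⟩⟩
      obtain rfl := huniq h h'
      exact ⟨g, ⟨hg, hg'⟩, h⟩
  | compl L _ hL =>
    refine starFreeClosure_congr (mem_starFreeClosure_and
      (mem_starFreeClosure_blockDecomposition (c := c) (D := D) (γ := γ) hC)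
      (mem_starFreeClosure_not hL)) fun v => ?_
    constructor
    · rintro ⟨g, hg, h⟩
      refine ⟨⟨g, h⟩, ?_⟩
      rintro ⟨g', hg', h'⟩
      obtain rfl := huniq h h'
      exact hg hg'
    · rintro ⟨⟨g, h⟩, hn⟩
      exact ⟨g, fun hg => hn ⟨g, hg, h⟩, h⟩
  | concat K L _ _ hK hL =>
    refine starFreeClosure_congr (mem_starFreeClosure_append hK hL) fun v => ?_
    constructor
    · rintro ⟨g, hg, h⟩
      obtain ⟨x, hx, y, hy, rfl⟩ := Language.mem_mul.1 hg
      obtain ⟨u, u', hu, hu', rfl⟩ := h.exists_append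
      exact ⟨u, u', ⟨x, hx, hu⟩, ⟨y, hy, hu'⟩, rfl⟩
    · rintro ⟨u, u', ⟨x, hx, hu⟩, ⟨y, hy, hu'⟩, rfl⟩
      exact ⟨x ++ y, Language.mem_mul.2 ⟨x, hx, y, hy, rfl⟩, hu.append hu'⟩

end Blocks

/-! Domination by elements of a closed submonoid -/

section Domination

variable {Q R : Type*} [IdemSemiring R]

/-- The order of `Q × R` for the trivial order of `Q`. -/
def Dominated (x y : Q × R) : Prop := x.1 = y.1 ∧ x.2 ≤ y.2

theorem Dominated.refl (x : Q × R) : Dominated x x := ⟨rfl, le_rfl⟩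

theorem Dominated.trans {x y z : Q × R} (h : Dominated x y) (h' : Dominated y z) :
    Dominated x z := ⟨h.1.trans h'.1, h.2.trans h'.2⟩

variable [Monoid Q]

theorem Dominated.mul_left {x y : Q × R} (h : Dominated x y) (z : Q × R) :
    Dominated (z * x) (z * y) := ⟨congrArg (z.1 * ·) h.1, mul_le_mul_right h.2 z.2⟩

theorem Dominated.mul_right {x y : Q × R} (h : Dominated x y) (z : Q × R) :
    Dominated (x * z) (y * z) := ⟨congrArg (· * z.1) h.1, mul_le_mul_left h.2 z.2⟩

/-- The submonoid `S` is star-free closed relatively to multiplication by `s` on the left. -/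
structure IsClosedAt (S : Submonoid (Q × R)) (s : Q × R) : Prop where
  exists_mul_eq : ∀ z ∈ S, ∃ z', s * z = z' * s
  exists_dominated : ∀ z ∈ S, (∃ n, (s * z ^ (n + 1)).1 = (s * z ^ n).1) →
    ∃ t ∈ S, Dominated (s * z ^ omegaExp (Q × R)) (s * t) ∧
      Dominated (s * z ^ (omegaExp (Q × R) + 1)) (s * t)

variable {S : Submonoid (Q × R)} {s : Q × R}

/-- Domination after `s` is not obviously stable under inserting `z` between `s` and the rest. The
commutation `s * z = z' * s` moves the insertion to the far left, where it is harmless. -/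
theorem IsClosedAt.mul_left (hS : IsClosedAt S s) {z x y : Q × R} (hz : z ∈ S)
    (h : Dominated (s * x) (s * y)) : Dominated (s * (z * x)) (s * (z * y)) := by
  obtain ⟨z', hz'⟩ := hS.exists_mul_eq z hz
  rw [← mul_assoc, ← mul_assoc, hz', mul_assoc, mul_assoc]
  exact h.mul_left z'

/-- The submonoid `S c ∪ {1}`. -/
def blockSubmonoid (S : Submonoid (Q × R)) (c : Q × R) (hc : c ∈ S) : Submonoid (Q × R) where
  carrier := {x | x = 1 ∨ ∃ u ∈ S, x = u * c}
  one_mem' := .inl rfl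
  mul_mem' := by
    rintro _ _ (rfl | ⟨u, hu, rfl⟩) (rfl | ⟨v, hv, rfl⟩)
    · exact .inl (one_mul 1)
    · exact .inr ⟨v, hv, one_mul _⟩
    · exact .inr ⟨u, hu, mul_one _⟩
    · exact .inr ⟨u * c * v, S.mul_mem (S.mul_mem hu hc) hv, (mul_assoc _ _ _).symm⟩

theorem blockSubmonoid_le {c : Q × R} (hc : c ∈ S) : blockSubmonoid S c hc ≤ S := by
  rintro _ (rfl | ⟨u, hu, rfl⟩)
  · exact S.one_mem
  · exact S.mul_mem hu hc

/-- The identity `c (u c) ^ k = (c u) ^ k c` transfers questions about `u c` after `s c` to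
questions about `c u` after `s`. -/
theorem IsClosedAt.blockSubmonoid [Finite Q] [Finite R] (hS : IsClosedAt S s) {c : Q × R}
    (hc : c ∈ S) : IsClosedAt (blockSubmonoid S c hc) (s * c) where
  exists_mul_eq := by
    rintro _ (rfl | ⟨u, hu, rfl⟩)
    · exact ⟨1, by simp⟩
    · obtain ⟨z', hz'⟩ := hS.exists_mul_eq (c * u) (S.mul_mem hc hu)
      exact ⟨z', by rw [← mul_assoc, mul_assoc s, hz', mul_assoc]⟩
  exists_dominated := by
    rintro _ (rfl | ⟨u, hu, rfl⟩) ⟨n, hn⟩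
    · exact ⟨1, Submonoid.one_mem _, by simpa using Dominated.refl _, by
        simpa using Dominated.refl _⟩
    have hcomm : ∀ k, s * c * (u * c) ^ k = s * (c * u) ^ k * c := by
      intro k
      have h : SemiconjBy c (u * c) (c * u) := by simp [SemiconjBy, mul_assoc]
      rw [mul_assoc, (h.pow_right k).eq, mul_assoc]
    have hcu : c * u ∈ S := S.mul_mem hc hu
    obtain ⟨hω, hidem⟩ := omegaExp_spec (Q × R)
    set ω := omegaExp (Q × R)
    obtain ⟨t, ht, h1, h2⟩ := hS.exists_dominated (c * u) hcu ⟨n + 1, by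
      have := congrArg (· * u.1) hn
      rw [hcomm, hcomm] at this
      simpa only [pow_succ _ (n + 1), pow_succ _ n, Prod.fst_mul, mul_assoc] using this⟩
    -- After `s * c` this witness yields `s * (c * u) ^ ω * t * c`. The extra factor `(c * u) ^ ω`
    -- puts the witness in `S c`; it only changes exponents `k` into `ω + k`, and idempotency
    -- absorbs this.
    refine ⟨u * (c * u) ^ (ω - 1) * t * c, .inr ⟨_, S.mul_mem (S.mul_mem hu (pow_mem hcu _)) ht,
      rfl⟩, ?_⟩
    have key : ∀ k, Dominated (s * (c * u) ^ k) (s * t) →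
        Dominated (s * c * (u * c) ^ (ω + k)) (s * c * (u * (c * u) ^ (ω - 1) * t * c)) := by
      intro k hk
      have := (hS.mul_left (pow_mem hcu ω) hk).mul_right c
      rw [← pow_add, ← hcomm] at this
      obtain ⟨m, hm⟩ : ∃ m, ω = m + 1 := ⟨ω - 1, by omega⟩
      convert this using 1
      rw [hm, Nat.add_sub_cancel, pow_succ']
      simp only [mul_assoc]
    have hωω : ∀ x : Q × R, x ^ (ω + ω) = x ^ ω := fun x => by rw [pow_add, (hidem x).eq]
    refine ⟨by simpa only [hωω] using key ω h1, ?_⟩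
    have := key (ω + 1) h2
    rwa [← add_assoc, pow_succ, hωω, ← pow_succ] at this

/-- The cardinality of `s S`. -/
noncomputable def orbitCard (S : Submonoid (Q × R)) (s : Q × R) : ℕ :=
  ((s * ·) '' (S : Set (Q × R))).ncard

/-- The new orbit lies in `(s S) c`, and right multiplication by `c` identifies two points of `s S`.
-/
theorem orbitCard_blockSubmonoid_lt [Finite Q] [Finite R] {c x y : Q × R} (hc : c ∈ S)
    (hx : x ∈ S) (hy : y ∈ S) (h : s * x * c = s * y * c) (hne : s * x ≠ s * y) :
    orbitCard (blockSubmonoid S c hc) (s * c) < orbitCard S s := by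
  have hsub : (s * c * ·) '' (blockSubmonoid S c hc : Set (Q × R)) ⊆
      (· * c) '' ((s * ·) '' (S : Set (Q × R))) := by
    rintro _ ⟨_, rfl | ⟨u, hu, rfl⟩, rfl⟩
    · exact ⟨_, ⟨1, S.one_mem, rfl⟩, by simp⟩
    · exact ⟨_, ⟨c * u, S.mul_mem hc hu, rfl⟩, by simp only [mul_assoc]⟩
  refine (Set.ncard_le_ncard hsub (Set.toFinite _)).trans_lt
    (lt_of_le_of_ne (Set.ncard_image_le (Set.toFinite _)) fun heq => hne ?_)
  exact (Set.ncard_image_iff (Set.toFinite _)).1 heq ⟨x, hx, rfl⟩ ⟨y, hy, rfl⟩ h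

/-! Star-free partitions -/

/-- The value of a word. -/
def wordValue {B : Type*} (φ : B → Q × R) (w : List B) : Q × R := (w.map φ).prod

/-- The languages recognized by `w ↦ s φ(w)` in the first component. -/
def recognizedClass {B : Type*} (φ : B → Q × R) (s : Q × R) : Set (Language B) :=
  {L | ∃ X : Set Q, L = {w | (s * wordValue φ w).1 ∈ X}}

/-- The words over `D` have a finite star-free partition whose members are dominated by elements
of `S` after multiplication by `s` on the left. -/
def HasDominatedPartition {B : Type*} (S : Submonoid (Q × R)) (s : Q × R) (φ : B → Q × R)
    (D : Set B) : Prop :=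
  ∃ τ : List B → S, (∀ w, IsOver D w → Dominated (s * wordValue φ w) (s * τ w)) ∧
    ∀ x, {w | IsOver D w ∧ τ w = x} ∈ starFreeClosure (recognizedClass φ s)

variable {B : Type*} {φ : B → Q × R} {D : Set B}

theorem wordValue_append (u v : List B) :
    wordValue φ (u ++ v) = wordValue φ u * wordValue φ v := by
  simp [wordValue]

theorem wordValue_cons (b : B) (v : List B) : wordValue φ (b :: v) = φ b * wordValue φ v := by
  simp [wordValue]

theorem wordValue_mem (hφ : ∀ b, φ b ∈ S) (w : List B) : wordValue φ w ∈ S :=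
  S.list_prod_mem fun _ hx => by
    obtain ⟨b, _, rfl⟩ := List.mem_map.1 hx
    exact hφ b

theorem top_mem_recognizedClass : (⊤ : Language B) ∈ recognizedClass φ s :=
  ⟨Set.univ, rfl⟩

/-- The witnesses for the individual `u` are multiplied. Since `s * u ^ ω = s`, each of them also
dominates `s` itself, so no factor spoils the others. -/
theorem IsClosedAt.exists_forall_dominated (hS : IsClosedAt S s) (I : Finset (Q × R))
    (hI : ∀ u ∈ I, u ∈ S ∧ s * u ^ omegaExp (Q × R) = s ∧ (s * u).1 = s.1) :
    ∃ t ∈ S, Dominated s (s * t) ∧ ∀ u ∈ I, Dominated (s * u) (s * t) := by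
  classical
  induction I using Finset.induction_on with
  | empty => exact ⟨1, S.one_mem, by simpa using Dominated.refl s, by simp⟩
  | insert u I _ ih =>
    obtain ⟨t, ht, hst, hIt⟩ := ih fun u hu => hI u (Finset.mem_insert_of_mem hu)
    obtain ⟨hu, hus, hus1⟩ := hI u (Finset.mem_insert_self u I)
    obtain ⟨t', ht', h1, h2⟩ := hS.exists_dominated u hu ⟨0, by simpa using hus1⟩
    rw [pow_succ, ← mul_assoc, hus] at h2
    rw [hus] at h1
    have h3 : Dominated (s * t) (s * (t * t')) := by
      have := hS.mul_left (x := 1) ht (by simpa using h1)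
      simpa using this
    refine ⟨t * t', S.mul_mem ht ht', hst.trans h3, fun v hv => ?_⟩
    rcases Finset.mem_insert.1 hv with rfl | hv
    · have := hst.mul_right t'
      rw [mul_assoc] at this
      exact h2.trans this
    · exact (hIt v hv).trans h3

/-- One factor `u ^ ω` is cancelled from `s x u ^ ω u ^ ω = s x u ^ ω`. -/
theorem mul_pow_omegaExp_eq [Finite Q] [Finite R] {u : Q × R} (hu : u ∈ S)
    (hinj : ∀ x ∈ S, ∀ y ∈ S, s * x * u = s * y * u → s * x = s * y) {x : Q × R} (hx : x ∈ S) :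
    s * x * u ^ omegaExp (Q × R) = s * x := by
  have hpow : ∀ n, ∀ x ∈ S, ∀ y ∈ S, s * x * u ^ n = s * y * u ^ n → s * x = s * y := by
    intro n
    induction n with
    | zero => simp
    | succ n ih =>
      intro x hx y hy h
      refine ih x hx y hy ?_
      rw [mul_assoc, mul_assoc]
      refine hinj _ (S.mul_mem hx (pow_mem hu n)) _ (S.mul_mem hy (pow_mem hu n)) ?_
      rwa [pow_succ, ← mul_assoc, ← mul_assoc, mul_assoc s x, mul_assoc s y] at h
  rw [mul_assoc]
  refine hpow (omegaExp (Q × R)) _ (S.mul_mem hx (pow_mem hu _)) x hx ?_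
  rw [mul_assoc, mul_assoc x, ((omegaExp_spec (Q × R)).2 u).eq, mul_assoc]

/-- For each first component `q`, fix a word of value `u₀` attaining it. Multiplying the values of
the other such words by `u₀ ^ (ω - 1)`, an inverse of `u₀` on `s S`, gives elements that keep the
first component of `s`, so one `t` dominates them all. Then `t * u₀` dominates the original values,
and the partition is by `q` alone. -/
theorem HasDominatedPartition.of_injective [Finite Q] [Finite R] [Finite B]
    (hS : IsClosedAt S s) (hφ : ∀ b, φ b ∈ S)
    (hinj : ∀ b ∈ D, ∀ x ∈ S, ∀ y ∈ S, s * x * φ b = s * y * φ b → s * x = s * y) :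
    HasDominatedPartition S s φ D := by
  have hword : ∀ w, IsOver D w → ∀ x ∈ S, ∀ y ∈ S,
      s * x * wordValue φ w = s * y * wordValue φ w → s * x = s * y := by
    intro w hw
    induction w with
    | nil => simp [wordValue]
    | cons b w ih =>
      obtain ⟨hb, hw⟩ := List.forall_mem_cons.1 hw
      intro x hx y hy h
      refine hinj b hb x hx y hy ?_
      rw [mul_assoc, mul_assoc]
      refine ih hw _ (S.mul_mem hx (hφ b)) _ (S.mul_mem hy (hφ b)) ?_
      simpa only [wordValue_cons, mul_assoc] using h
  have hω : ∀ w, IsOver D w → ∀ x ∈ S, s * x * wordValue φ w ^ omegaExp (Q × R) = s * x :=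
    fun w hw x hx => mul_pow_omegaExp_eq (wordValue_mem hφ w) (hword w hw) hx
  have hω1 := (omegaExp_spec (Q × R)).1
  set ω := omegaExp (Q × R) with hω_def
  have hclass : ∀ q : Q, ∃ t : S, ∀ w, IsOver D w → (s * wordValue φ w).1 = q →
      Dominated (s * wordValue φ w) (s * t) := by
    intro q
    by_cases hq : ∃ w, IsOver D w ∧ (s * wordValue φ w).1 = q
    · obtain ⟨w₀, hw₀, rfl⟩ := hq
      set u₀ := wordValue φ w₀
      have hu₀ : u₀ ∈ S := wordValue_mem hφ w₀
      have hpow : u₀ ^ (ω - 1) * u₀ = u₀ ^ ω := by rw [← pow_succ, Nat.sub_add_cancel hω1]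
      have hs₀ : s * u₀ ^ ω = s := by simpa using hω w₀ hw₀ 1 S.one_mem
      let I : Set (Q × R) := {u | ∃ w, IsOver D w ∧ (s * wordValue φ w).1 = (s * u₀).1 ∧
        u = wordValue φ w * u₀ ^ (ω - 1)}
      obtain ⟨t, ht, -, hI⟩ := hS.exists_forall_dominated (Set.toFinite I).toFinset (by
        simp only [Set.Finite.mem_toFinset]
        rintro _ ⟨w, hw, hwq, rfl⟩
        have hmem : wordValue φ w * u₀ ^ (ω - 1) ∈ S :=
          S.mul_mem (wordValue_mem hφ w) (pow_mem hu₀ _)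
        refine ⟨hmem, ?_, ?_⟩
        · have := mul_pow_omegaExp_eq (s := s) hmem (fun x hx y hy h => ?_) S.one_mem
          · simpa using this
          -- A further factor `u₀` completes `u₀ ^ ω`, which acts trivially, leaving the injective
          -- action of `w`.
          · have h' := congrArg (· * u₀) h
            simp only [mul_assoc, hpow] at h'
            simp only [← mul_assoc] at h'
            rw [mul_assoc s x, mul_assoc s y, hω w₀ hw₀ _ (S.mul_mem hx (wordValue_mem hφ w)),
              hω w₀ hw₀ _ (S.mul_mem hy (wordValue_mem hφ w)), ← mul_assoc, ← mul_assoc] at h'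
            exact hword w hw x hx y hy h'
        · rw [← mul_assoc, Prod.fst_mul, hwq, ← Prod.fst_mul, mul_assoc, ← pow_succ',
            Nat.sub_add_cancel hω1, hs₀])
      refine ⟨⟨t * u₀, S.mul_mem ht hu₀⟩, fun w hw hwq => ?_⟩
      have := (hI _ ((Set.Finite.mem_toFinset _).2 ⟨w, hw, hwq, rfl⟩)).mul_right u₀
      rw [mul_assoc, mul_assoc, hpow, ← mul_assoc, hω w₀ hw₀ _ (wordValue_mem hφ w),
        mul_assoc] at this
      exact this
    · exact ⟨1, fun w hw hwq => absurd ⟨w, hw, hwq⟩ hq⟩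
  choose t ht using hclass
  refine ⟨fun w => t (s * wordValue φ w).1, fun w hw => ht _ w hw rfl, fun x => ?_⟩
  exact mem_starFreeClosure_and (mem_starFreeClosure_forall_mem top_mem_recognizedClass D)
    (.base _ ⟨{q | t q = x}, rfl⟩)

theorem BlockDecomposition.dominated {Γ : Type*} {c : B} {v : List B} {g : List Γ}
    {τ : List B → S} {γ : List B → Γ} {ψ : Γ → Q × R} (hS : IsClosedAt S s) (hc : φ c ∈ S)
    (hτ : ∀ w, IsOver D w → Dominated (s * wordValue φ w) (s * τ w))
    (hψ : ∀ k, ψ (γ k) = τ k * φ c) (h : BlockDecomposition c D γ v g) :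
    Dominated (s * wordValue φ v) (s * wordValue ψ g) := by
  induction h with
  | nil => exact Dominated.refl _
  | cons k v g hk _ ih =>
    rw [wordValue_append, wordValue_cons, wordValue_cons, hψ]
    have h1 := (hτ k hk).mul_right (φ c * wordValue φ v)
    have h2 := hS.mul_left (S.mul_mem (τ k).2 hc) ih
    simp only [mul_assoc] at h1 h2 ⊢
    exact h1.trans h2

end Domination

/-! The least saturated set -/

section Completeness

variable {Q R : Type*} [Monoid Q] [IdemSemiring R] [Finite Q] [Finite R]
  {S : Submonoid (Q × R)} {s : Q × R}

/-- A word containing `c` is uniquely `k c v k'` with `k`, `k'` over `D` and `v` a product of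
blocks. The first `c` is split off so that the block word is read after `s * φ c`, as `hblock`
requires. -/
theorem HasDominatedPartition.of_block {B : Type*} [Finite B] {φ : B → Q × R} {D : Set B} {c : B}
    (hS : IsClosedAt S s) (hφ : ∀ b, φ b ∈ S) (hc : c ∉ D) (h : HasDominatedPartition S s φ D)
    (hblock : HasDominatedPartition (blockSubmonoid S (φ c) (hφ c)) (s * φ c)
      (Subtype.val : blockSubmonoid S (φ c) (hφ c) → Q × R) Set.univ) :
    HasDominatedPartition S s φ (insert c D) := by
  obtain ⟨τ, hτ, hτmem⟩ := h
  set T := blockSubmonoid S (φ c) (hφ c)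
  obtain ⟨τ', hτ', hτ'mem⟩ := hblock
  have hTS : T ≤ S := blockSubmonoid_le (hφ c)
  have htop := top_mem_recognizedClass (φ := φ) (s := s)
  let γ : List B → T := fun k => ⟨τ k * φ c, .inr ⟨_, (τ k).2, rfl⟩⟩
  let cS : S := ⟨φ c, hφ c⟩
  let f : S → T → S → S := fun x y z => x * cS * ⟨y, hTS y.2⟩ * z
  -- The nesting of the existentials follows the concatenation `k · c · v · k'`, so that closure
  -- under concatenation applies directly.
  let P : List B → S → Prop := fun w x => (IsOver D w ∧ τ w = x) ∨
    ∃ (x₀ : S) (y : T) (x₁ : S), f x₀ y x₁ = x ∧ ∃ k w', (IsOver D k ∧ τ k = x₀) ∧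
      (∃ l w'', l = [c] ∧ (∃ v k', (∃ g, τ' g = y ∧ BlockDecomposition c D γ v g) ∧
        (IsOver D k' ∧ τ k' = x₁) ∧ w'' = v ++ k') ∧ w' = l ++ w'') ∧ w = k ++ w'
  have hsub := Set.subset_insert c D
  have hcD := Set.mem_insert c D
  have hPover : ∀ w x, P w x → IsOver (insert c D) w := by
    rintro w x (⟨hw, -⟩ | ⟨x₀, y, x₁, -, k, _, ⟨hk, -⟩, ⟨_, _, rfl, ⟨v, k', ⟨g, -, hv⟩, ⟨hk', -⟩,
      rfl⟩, rfl⟩, rfl⟩)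
    · exact hw.mono hsub
    · exact (hk.mono hsub).append ((hv.isOver.append (hk'.mono hsub)).cons hcD)
  have hPunique : ∀ w x x', P w x → P w x' → x = x' := by
    rintro w x x' (⟨hw, rfl⟩ | ⟨_, _, _, rfl, k, _, ⟨hk, rfl⟩, ⟨_, _, rfl, ⟨v, k', ⟨g, rfl, hv⟩,
      ⟨hk', rfl⟩, rfl⟩, rfl⟩, rfl⟩)
      (⟨hw', rfl⟩ | ⟨_, _, _, rfl, l, _, ⟨hl, rfl⟩, ⟨_, _, rfl, ⟨u, l', ⟨g', rfl, hu⟩,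
      ⟨hl', rfl⟩, rfl⟩, rfl⟩, heq⟩)
    · rfl
    · exact absurd (hw c (by simp [heq])) hc
    · exact absurd (hw' c (by simp)) hc
    · obtain ⟨rfl, heq'⟩ := append_cons_inj hc hk hl heq
      obtain ⟨rfl, rfl, rfl⟩ := hv.unique hc hu hk' hl' heq'
      rfl
  have hPexists : ∀ w, IsOver (insert c D) w → ∃ x, P w x := by
    intro w hw
    obtain ⟨v, g, k, hv, hk, rfl⟩ := exists_blockDecomposition γ hw
    cases hv with
    | nil => exact ⟨_, .inl ⟨hk, rfl⟩⟩
    | cons l v g hl hv =>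
      exact ⟨_, .inr ⟨_, _, _, rfl, l, _, ⟨hl, rfl⟩, ⟨_, _, rfl, ⟨v, k, ⟨g, rfl, hv⟩,
        ⟨hk, rfl⟩, rfl⟩, rfl⟩, by simp⟩⟩
  have hPdom : ∀ w x, P w x → Dominated (s * wordValue φ w) (s * x) := by
    rintro w x (⟨hw, rfl⟩ | ⟨_, _, _, rfl, k, _, ⟨hk, rfl⟩, ⟨_, _, rfl, ⟨v, k', ⟨g, rfl, hv⟩,
      ⟨hk', rfl⟩, rfl⟩, rfl⟩, rfl⟩)
    · exact hτ w hw
    · have h1 := (hτ k hk).mul_right (φ c * (wordValue φ v * wordValue φ k'))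
      have h2 := hS.mul_left (hφ c) (hv.dominated (ψ := Subtype.val) hS (hφ c) hτ fun _ => rfl)
      have h3 := hτ' g fun _ _ => Set.mem_univ _
      have h4 : Dominated (s * (φ c * wordValue φ v)) (s * (φ c * τ' g)) := by
        simp only [mul_assoc] at h2 h3
        exact h2.trans h3
      have h5 := (hS.mul_left (τ k).2 h4).mul_right (wordValue φ k')
      have h6 := hS.mul_left (S.mul_mem (S.mul_mem (τ k).2 (hφ c)) (hTS (τ' g).2)) (hτ k' hk')
      simp only [wordValue_append, wordValue_cons, List.singleton_append, f, cS,
        Submonoid.coe_mul]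
      simp only [mul_assoc] at h1 h5 h6 ⊢
      exact h1.trans (h5.trans h6)
  have hPmem : ∀ x, {w | P w x} ∈ starFreeClosure (recognizedClass φ s) := by
    have hpull : ∀ y : T, {v | ∃ g, τ' g = y ∧ BlockDecomposition c D γ v g} ∈
        starFreeClosure (recognizedClass φ s) := by
      intro y
      refine starFreeClosure_congr (mem_starFreeClosure_of_blockDecomposition
        (γ := γ) (D := D) (c := c) htop hc ?_ ?_ (hτ'mem y)) fun v => ?_
      · rintro _ ⟨X, rfl⟩
        -- Writing `s * φ c = z * s` lets the first component of the block word after `s * φ c` be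
        -- computed from that of `v` after `s`, so the preimage is recognized by `φ`.
        obtain ⟨z, hz⟩ := hS.exists_mul_eq _ (hφ c)
        refine starFreeClosure_congr (mem_starFreeClosure_and
          (mem_starFreeClosure_blockDecomposition (c := c) (D := D) (γ := γ) htop)
          (.base _ ⟨{q | z.1 * q ∈ X}, rfl⟩)) fun v => ?_
        have hval : ∀ {g}, BlockDecomposition c D γ v g →
            (s * φ c * wordValue Subtype.val g).1 = z.1 * (s * wordValue φ v).1 := by
          intro g hv
          have h := (hv.dominated (ψ := Subtype.val) hS (hφ c) hτ fun _ => rfl).1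
          rw [h, ← Prod.fst_mul, ← mul_assoc, hz]
        constructor
        · rintro ⟨g, hg, hv⟩
          refine ⟨⟨g, hv⟩, ?_⟩
          change z.1 * (s * wordValue φ v).1 ∈ X
          rw [← hval hv]
          exact hg
        · rintro ⟨⟨g, hv⟩, hX⟩
          refine ⟨g, ?_, hv⟩
          change z.1 * (s * wordValue φ v).1 ∈ X at hX
          rw [← hval hv] at hX
          exact hX
      · intro x
        have := mem_starFreeClosure_exists htop fun y : S =>
          mem_starFreeClosure_and (hτmem y)
            (mem_starFreeClosure_true htop ((y : Q × R) * φ c = x))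
        refine starFreeClosure_congr this fun k => ?_
        constructor
        · rintro ⟨hk, rfl⟩
          exact ⟨_, ⟨hk, rfl⟩, rfl⟩
        · rintro ⟨_, ⟨hk, rfl⟩, hx⟩
          exact ⟨hk, Subtype.ext hx⟩
      · constructor
        · rintro ⟨g, hg, hv⟩
          exact ⟨g, ⟨fun _ _ => Set.mem_univ _, hg⟩, hv⟩
        · rintro ⟨g, ⟨_, hg⟩, hv⟩
          exact ⟨g, hg, hv⟩
    intro x
    refine mem_starFreeClosure_or (hτmem x) ?_
    refine mem_starFreeClosure_exists htop fun x₀ => mem_starFreeClosure_exists htop fun y =>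
      mem_starFreeClosure_exists htop fun x₁ => ?_
    exact mem_starFreeClosure_and (mem_starFreeClosure_true htop _)
      (mem_starFreeClosure_append (hτmem x₀) (mem_starFreeClosure_append
        (mem_starFreeClosure_letter c) (mem_starFreeClosure_append (hpull y) (hτmem x₁))))
  choose! σ hσ using hPexists
  refine ⟨σ, fun w hw => hPdom w _ (hσ w hw), fun x => ?_⟩
  refine starFreeClosure_congr (hPmem x) fun w => ?_
  constructor
  · rintro ⟨hw, rfl⟩
    exact hσ w hw
  · intro hw
    exact ⟨hPover w x hw, hPunique w _ _ (hσ w (hPover w x hw)) hw⟩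

theorem hasDominatedPartition_of_lt {B : Type*} [Finite B] {φ : B → Q × R}
    (hS : IsClosedAt S s) (hφ : ∀ b, φ b ∈ S)
    (ih : ∀ (S' : Submonoid (Q × R)) (s' : Q × R), IsClosedAt S' s' →
      orbitCard S' s' < orbitCard S s →
        HasDominatedPartition S' s' (Subtype.val : S' → Q × R) Set.univ) (D : Set B) :
    HasDominatedPartition S s φ D := by
  induction hn : D.ncard using Nat.strong_induction_on generalizing D with
  | _ n ihn =>
    by_cases hinj : ∀ b ∈ D, ∀ x ∈ S, ∀ y ∈ S, s * x * φ b = s * y * φ b → s * x = s * y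
    · exact .of_injective hS hφ hinj
    · push Not at hinj
      obtain ⟨c, hc, x, hx, y, hy, h, hne⟩ := hinj
      rw [← Set.insert_sdiff_self_of_mem hc]
      refine .of_block hS hφ (fun h => h.2 rfl) ?_
        (ih _ _ (hS.blockSubmonoid (hφ c)) (orbitCard_blockSubmonoid_lt (hφ c) hx hy h hne))
      exact ihn _ (hn ▸ Set.ncard_sdiff_singleton_lt_of_mem hc) _ rfl

/-- The recursion only meets alphabets that are themselves submonoids, so the outer induction is run
for these; any other finite alphabet then takes one more pass. -/
theorem IsClosedAt.hasDominatedPartition_val (hS : IsClosedAt S s) :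
    HasDominatedPartition S s (Subtype.val : S → Q × R) Set.univ := by
  induction hn : orbitCard S s using Nat.strong_induction_on generalizing S s with
  | _ n ihn =>
    exact hasDominatedPartition_of_lt hS (fun b => b.2)
      (fun S' s' hS' hlt => ihn _ (hn ▸ hlt) hS' rfl) _

theorem IsClosedAt.hasDominatedPartition {B : Type*} [Finite B] {φ : B → Q × R}
    (hS : IsClosedAt S s) (hφ : ∀ b, φ b ∈ S) : HasDominatedPartition S s φ Set.univ :=
  hasDominatedPartition_of_lt hS hφ (fun _ _ hS' _ => hS'.hasDominatedPartition_val) _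

/-- The two exponents may differ, but the idempotent power of `r` is unique. -/
theorem pow_omegaExp_prod_snd (r : R) : r ^ omegaExp (Q × R) = r ^ omegaExp R := by
  obtain ⟨h1, h2⟩ := omegaExp_spec (Q × R)
  obtain ⟨h3, h4⟩ := omegaExp_spec R
  have h5 : IsIdempotentElem (r ^ omegaExp (Q × R)) := congrArg Prod.snd (h2 (1, r))
  rw [← h5.pow_eq h3.ne', ← pow_mul, mul_comm, pow_mul, (h4 r).pow_eq h1.ne']

theorem isClosedAt_one (h : ∀ (e : Q) (r : R), (e, r) ∈ S → IsIdempotentElem e →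
    (e, r ^ omegaExp R + r ^ (omegaExp R + 1)) ∈ S) : IsClosedAt S 1 where
  exists_mul_eq z _ := ⟨z, by simp⟩
  exists_dominated := by
    rintro ⟨q, r⟩ hz ⟨n, hn⟩
    obtain ⟨hω, hidem⟩ := omegaExp_spec (Q × R)
    have hr := pow_omegaExp_prod_snd (Q := Q) r
    have hqω : IsIdempotentElem (q ^ omegaExp (Q × R)) := congrArg Prod.fst (hidem (q, r))
    have hrω : IsIdempotentElem (r ^ omegaExp (Q × R)) := congrArg Prod.snd (hidem (q, r))
    set ω := omegaExp (Q × R)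
    simp only [one_mul, Prod.pow_fst] at hn
    have hstab : ∀ m, q ^ (n + m) = q ^ n := by
      intro m
      induction m with
      | zero => rfl
      | succ m ih => rw [← add_assoc, pow_succ, ih, ← pow_succ, hn]
    have hqn : ∀ m, n ≤ m → q ^ m = q ^ ω := by
      intro m hm
      have h1 := hstab (m - n)
      have h2 := hstab (ω * (n + 1) - n)
      rw [Nat.add_sub_cancel' hm] at h1
      rw [Nat.add_sub_cancel' (by nlinarith), pow_mul, hqω.pow_eq (by omega)] at h2
      rw [h1, h2]
    have hk : n ≤ ω * (n + 1) := by nlinarith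
    -- Saturation needs an idempotent first component, which `q` need not be. This power of the pair
    -- has one, because the powers of `q` are constant from `n` on; its exponent is one more than a
    -- multiple of `ω`, so the resulting sum is still `r ^ ω + r ^ (ω + 1)`.
    have hz' : (q ^ ω, r ^ (ω * (n + 1) + 1)) ∈ S := by
      rw [← hqn (ω * (n + 1) + 1) (by omega)]
      exact pow_mem hz _
    have hmem := h _ _ hz' hqω
    have hq : q ^ (ω + 1) = q ^ ω := by
      rw [pow_succ, ← hqn _ hk, ← pow_succ]
      exact (hqn _ (by omega)).trans (hqn _ hk).symm
    have hrk : (r ^ (ω * (n + 1) + 1)) ^ omegaExp R = r ^ ω := by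
      rw [← pow_mul, mul_comm, pow_mul, ← hr, hrω.pow_eq (by omega)]
    have hrk' : (r ^ (ω * (n + 1) + 1)) ^ (omegaExp R + 1) = r ^ (ω + 1) := by
      rw [pow_succ, hrk, pow_succ, pow_mul, hrω.pow_eq (by omega), ← mul_assoc, hrω.eq, pow_succ]
    refine ⟨_, hmem, ?_⟩
    rw [hrk, hrk', add_eq_sup]
    simp only [one_mul]
    exact ⟨⟨rfl, le_sup_left⟩, ⟨hq, le_sup_right⟩⟩

end Completeness

/-! ### Every saturated set contains the pointed optimal imprint -/

section Least

variable {A R : Type*} [IdemSemiring R] {C : Set (Language A)}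
  {hC : IsQuotientClosedBooleanAlgebra C} {ρ : MultiplicativeRatingMap A R}

/-- A saturated set, as a submonoid. -/
def IsSaturated.toSubmonoid {S : Set (Classes C hC × R)} (hS : IsSaturated C hC ρ S) :
    Submonoid (Classes C hC × R) where
  carrier := S
  one_mem' := by
    have := hS.trivial_mem []
    rwa [show ({[]} : Language A) = 1 from rfl, map_one] at this
  mul_mem' := hS.mul_mem _ _ _ _

theorem wordValue_eq (w : List A) :
    wordValue (fun a => (classOf C hC [a], ρ ({[a]} : Language A))) w =
      (classOf C hC w, ρ ({w} : Language A)) := by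
  induction w with
  | nil =>
    rw [show ({[]} : Language A) = 1 from rfl, map_one]
    rfl
  | cons a w ih =>
    have : ({a :: w} : Language A) = {[a]} * {w} := by
      ext v
      rw [Language.mem_mul]
      constructor
      · intro h
        exact ⟨[a], rfl, w, rfl, h.symm⟩
      · rintro ⟨_, rfl, _, rfl, rfl⟩
        rfl
    rw [wordValue_cons, ih, this, map_mul]
    rfl

theorem pointedOptimalImprint_subset [Finite A] [Finite R] (hfin : C.Finite) (hρ : IsNice ρ)
    {S : Set (Classes C hC × R)} (hS : IsSaturated C hC ρ S) :
    pointedOptimalImprint C hC ρ ⊆ S := by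
  have := finite_classes hC hfin
  have hclosed : IsClosedAt hS.toSubmonoid 1 := isClosedAt_one hS.closure_mem
  obtain ⟨τ, hτ, hτmem⟩ := hclosed.hasDominatedPartition
    (φ := fun a : A => (classOf C hC [a], ρ ({[a]} : Language A))) fun a => hS.trivial_mem [a]
  simp only [one_mul, wordValue_eq] at hτ
  have huniv : ∀ w : List A, IsOver Set.univ w := fun _ _ _ => Set.mem_univ _
  have hmono : starFreeClosure (recognizedClass
      (fun a : A => (classOf C hC [a], ρ ({[a]} : Language A))) 1) ⊆ starFreeClosure C := by
    refine starFreeClosure_mono ?_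
    rintro _ ⟨X, rfl⟩
    simp only [one_mul, wordValue_eq]
    have := mem_starFreeClosure_exists hC.univ_mem fun q : Classes C hC =>
      mem_starFreeClosure_and (mem_starFreeClosure_classOf hfin q)
        (mem_starFreeClosure_true hC.univ_mem (q ∈ X))
    refine starFreeClosure_congr this fun w => ?_
    exact ⟨fun h => ⟨_, rfl, h⟩, by rintro ⟨_, rfl, hX⟩; exact hX⟩
  rintro ⟨c, r⟩ hr
  -- The cover consists of the members of the partition that meet the class `c`.
  obtain ⟨_, ⟨w, hw, rfl⟩, hle⟩ :=
    (mem_optimalImprint_iff (isBooleanAlgebra_starFreeClosure hC.toIsBooleanAlgebra)).1 hr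
      ((fun w => {v | IsOver Set.univ v ∧ τ v = τ w}) '' {w | classOf C hC w = c}) (by
    refine ⟨(Set.finite_range fun x => {v | IsOver Set.univ v ∧ τ v = x}).subset ?_, ?_, ?_⟩
    · rintro _ ⟨w, _, rfl⟩
      exact ⟨_, rfl⟩
    · rintro _ ⟨w, _, rfl⟩
      exact hmono (hτmem _)
    · intro w hw
      exact ⟨_, ⟨w, hw, rfl⟩, huniv w, rfl⟩)
  have hc : (τ w : Classes C hC × R).1 = c := (hτ w (huniv w)).1.symm.trans hw
  have hmem : (τ w : Classes C hC × R) ∈ S := (τ w).2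
  rw [← hc]
  refine hS.downset _ _ _ hmem (hle.trans ?_)
  -- Domination bounds single words only; niceness writes the rating of the whole member as a finite
  -- sum of these.
  obtain ⟨F, hF, hsum⟩ := hρ {v | IsOver Set.univ v ∧ τ v = τ w} ⟨w, huniv w, rfl⟩
  have hsumle : ∑ v ∈ F, ρ ({v} : Language A) ≤ (τ w : Classes C hC × R).2 := by
    refine Finset.sum_induction (fun v : List A => ρ ({v} : Language A))
      (fun x => x ≤ (τ w : Classes C hC × R).2) (fun _ _ => add_le) (bot_eq_zero (α := R) ▸ bot_le) fun v hv => ?_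
    rw [← (hF v hv).2]
    exact (hτ v (huniv v)).2
  exact hsum.le.trans hsumle

end Least

end StarFree

/-- For a finite quotient-closed Boolean algebra `C` and a nice multiplicative rating map `ρ`, the
set of pairs `(c, r)` with `r` in the optimal `ρ`-imprint on the class `c` for the star-free closure
of `C` is the least saturated set. -/
theorem mainTheorem4 {A R : Type*} [Finite A] [IdemSemiring R] [Finite R]
    (C : Set (Language A)) (hC : StarFree.IsQuotientClosedBooleanAlgebra C) (hfin : C.Finite)
    (ρ : StarFree.MultiplicativeRatingMap A R) (hρ : StarFree.IsNice ρ) :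
    IsLeast {S | StarFree.IsSaturated C hC ρ S} (StarFree.pointedOptimalImprint C hC ρ) :=
  ⟨StarFree.isSaturated_pointedOptimalImprint hC hfin ρ,
    fun _ hS => StarFree.pointedOptimalImprint_subset hfin hρ hS⟩
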